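/- **Model.** An asynchronous message-passing system has pairwise disjoint sets of writers $\mathcal W$ (totally ordered), readers $\mathcal R$ and servers $\mathcal S$, with $|\mathcal S|=n$ finite. Writers and readers are called clients. Links between processes neither create, alter nor duplicate messages, but delay them arbitrarily. A group-send sends one message to each server. Every response of a server is matched to the group-send that requested it, and a process counts only responses to the group-send of its current phase. A client may fail at any time and then takes no further step. A client invokes a new operation only when its previous ones are complete. A server is active, crashed or in repair. It may crash at any time when it is not crashed, and then loses all its state. A repair can be triggered at any time when it is crashed. A process may also fail (crash) in the middle of a group-send, so that only some servers are sent the message. No bound is assumed on the number, rate or overlap of failures, crashes and repairs. **Algorithm RADON-S.** Values lie in a set $V$ with initial value $v_0$. Tags are pairs $(z,w)\in\mathbb N\times\mathcal W$ ordered lexicographically, with an initial tag $t_0$. "Majority" means more than $n/2$ of all $n$ servers. Each server stores $(t_{loc},v_{loc})$, initially $(t_0,v_0)$, and a set $Seen$ of pairs (tag, client), initially empty; initially all servers are active. Only active servers respond to requests. * $write(v)$ by $w$: (get-tag) query all servers for $t_{loc}$, await a majority, and let $t^*$ be the largest tag received; (put-data) send $(t_w,v)$ with $t_w=(t^*.z+1,w)$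 to all servers and await acks from a set $\mathcal S_\alpha$ of at least $\lceil (3n+1)/4\rceil$ servers; (confirm-data) send a confirm request for $t_w$ to all servers and terminate after acks from a majority of servers, all of them in $\mathcal S_\alpha$. * $read$: (get-data) query all servers for $(t_{loc},v_{loc})$, await a majority, and let $(t_r,v_r)$ be a received pair with the largest tag; then perform put-data with $(t_r,v_r)$ and confirm-data with $t_r$ as above, and return $v_r$. * An active server that receives put-data $(t,v)$ from a client $c$ sets $(t_{loc},v_{loc})\leftarrow(t,v)$ if $t>t_{loc}$, adds $(t,c)$ to $Seen$, and sends an ack. An active server that receives a confirm request for $t$ from $c$ removes $(t,c)$ from $Seen$ and sends an ack if $(t,c)\in Seen$, and does nothing otherwise. * Repair: the server resets $(t_{loc},v_{loc})$ to $(t_0,v_0)$ and $Seen$ to $\emptyset$, queries all servers for $(t_{loc},v_{loc})$, awaits responses from a majority, stores a received pair with the largest tag, and becomes active. **Atomicity.** An execution is atomic if there are a set $L$ consisting of all its complete and some of its incomplete read and write operations, and distinct points of time, one for each operation in $L$, each after the invocation of its operation and (if the operation is complete) before its response, such that every complete read returns the value of the write in $L$ with the last point before its own, or $v_0$ if no write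 in $L$ has an earlier point. **Theorem.** Every execution of RADON-S, finite or infinite, is atomic. -/

import Mathlib

namespace RadonS

/-- Tags `(z, w)`, ordered lexicographically. -/
abbrev Tag (W : Type*) := ℕ ×ₗ W

/-- Clients: writers and readers. -/
inductive Client (W R : Type*)
  | writer (w : W)
  | reader (r : R)

/-- Processes: clients and servers. -/
inductive Proc (W R S : Type*)
  | client (c : Client W R)
  | server (s : S)

/-- Contents of the messages that are group-sent to the servers. -/
inductive Request (W V : Type*)
  | queryTag
  | queryTagData
  | putData (t : Tag W) (v : V)
  | confirmData (t : Tag W)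
  | repairTagData

/-- Contents of the responses of the servers. -/
inductive Reply (W V : Type*)
  | tag (t : Tag W)
  | tagData (t : Tag W) (v : V)
  | ack

/-- Messages on the links. The number `k` identifies the group-send that a request belongs to; a
response repeats it, so that it is counted only in the phase which asked for it. -/
inductive Msg (W R S V : Type*)
  | req (src : Proc W R S) (k : ℕ) (dst : S) (body : Request W V)
  | rep (src : S) (k : ℕ) (dst : Proc W R S) (body : Reply W V)

/-- Local state of a client. In each phase, `k` identifies the group-send whose responses are
awaited; `resp` and `acks` record the responses received so far. -/
inductive ClientState (W S V : Type*)
  | idle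
  | failed
  /-- *get-tag* phase of `write(v)` -/
  | getTag (v : V) (k : ℕ) (resp : S → Option (Tag W))
  /-- *get-data* phase of a read -/
  | getData (k : ℕ) (resp : S → Option (Tag W × V))
  /-- *put-data* phase for the pair `(t, v)` -/
  | putData (k : ℕ) (t : Tag W) (v : V) (acks : Finset S)
  /-- *confirm-data* phase for `t`; `Sα` is the set of servers that acknowledged *put-data* -/
  | confirm (k : ℕ) (t : Tag W) (v : V) (Sα : Finset S) (acks : Finset S)

/-- Status of a server. In the repair state, `k` identifies the group-send of the present repair
operation and `resp` records the responses received so far. -/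
inductive Status (W S V : Type*)
  | active
  | crashed
  | repair (k : ℕ) (resp : S → Option (Tag W × V))

/-- State variables of a server. -/
structure ServerState (W R S V : Type*) where
  status : Status W S V
  tloc : Tag W
  vloc : V
  seen : Set (Tag W × Client W R)

/-- Global states. `net` holds the messages in transit: no two of them coincide, since a group-send
puts one message per server and a server sends at most one response to each request. `nextId` is
the identifier of the next group-send. -/
structure Config (W R S V : Type*) where
  client : Client W R → ClientState W S V
  server : S → ServerState W R S V
  net : Set (Msg W R S V)
  nextId : ℕ

/-- Labels of steps: invocations and responses of operations, and all other steps. -/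
inductive Label (W R V : Type*)
  | invWrite (w : W) (v : V)
  | invRead (r : R)
  | respWrite (w : W)
  | respRead (r : R) (v : V)
  | internal

section Algorithm

variable {W R S V : Type*}

/-- All state variables at their default values. -/
def ServerState.default (t₀ : Tag W) (v₀ : V) (st : Status W S V) : ServerState W R S V :=
  ⟨st, t₀, v₀, ∅⟩

/-- Initially all clients are idle, all servers are active, and no message is in transit. -/
def Config.init (t₀ : Tag W) (v₀ : V) : Config W R S V where
  client := fun _ => .idle
  server := fun _ => ServerState.default t₀ v₀ .active
  net := ∅
  nextId := 0

open Classical in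
/-- Overwrite the state of a client. -/
noncomputable def Config.setClient (σ : Config W R S V) (c : Client W R)
    (x : ClientState W S V) : Config W R S V :=
  { σ with client := Function.update σ.client c x }

open Classical in
/-- Overwrite the state of a server. -/
noncomputable def Config.setServer (σ : Config W R S V) (s : S)
    (x : ServerState W R S V) : Config W R S V :=
  { σ with server := Function.update σ.server s x }

/-- Process `p` sends `m` to the servers in `D`, under a fresh identifier. -/
def Config.groupSend (σ : Config W R S V) (p : Proc W R S) (m : Request W V)
    (D : Finset S) : Config W R S V :=
  { σ with
    net := σ.net ∪ {x | ∃ s ∈ D, x = Msg.req p σ.nextId s m}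
    nextId := σ.nextId + 1 }

open Classical in
/-- A client that group-sends either sends to all servers and moves on to the next state `x`, or
fails after having sent to the servers in `D` only. -/
noncomputable def Config.clientSend [Fintype S] (σ : Config W R S V) (c : Client W R)
    (m : Request W V) (D : Finset S) (x : ClientState W S V) : Config W R S V :=
  (σ.groupSend (.client c) m D).setClient c (if D = Finset.univ then x else .failed)

/-- A majority of all servers. -/
def Majority [Fintype S] (Q : Finset S) : Prop := Fintype.card S < 2 * Q.card

/-- The servers whose response has been recorded. -/
def responders {A : Type*} [Fintype S] (resp : S → Option A) : Finset S :=
  Finset.univ.filter fun s => (resp s).isSome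

/-- `(t, v)` is a recorded response with the largest tag. -/
def IsMaxResp [Fintype S] (resp : S → Option (Tag W × V)) [LinearOrder W]
    (t : Tag W) (v : V) : Prop :=
  (∃ s, resp s = some (t, v)) ∧ ∀ s t' v', resp s = some (t', v') → t' ≤ t

open Classical in
/-- A client records a response of server `s` to its group-send `k`; any response that it does not
await in its present phase is ignored. -/
noncomputable def ClientState.recv (st : ClientState W S V) (s : S) (k : ℕ) (b : Reply W V) :
    ClientState W S V :=
  match st, b with
  | .getTag v k' resp, .tag t =>
      if k = k' then .getTag v k' (Function.update resp s (some t)) else st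
  | .getData k' resp, .tagData t v =>
      if k = k' then .getData k' (Function.update resp s (some (t, v))) else st
  | .putData k' t v acks, .ack =>
      if k = k' then .putData k' t v (insert s acks) else st
  | .confirm k' t v Sα acks, .ack =>
      if k = k' then .confirm k' t v Sα (insert s acks) else st
  | st, _ => st

open Classical in
/-- A server in the repair state records the responses to its present repair operation; every other
response that reaches a server is ignored or lost. -/
noncomputable def ServerState.recv (x : ServerState W R S V) (s : S) (k : ℕ) (b : Reply W V) :
    ServerState W R S V :=
  match x.status, b with
  | .repair k' resp, .tagData t v =>
      if k = k' then { x with status := .repair k' (Function.update resp s (some (t, v))) } else x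
  | _, _ => x

open Classical in
/-- Reaction of a server to a request from `p`: its new state, and its response if there is one.
A server that is not active does not react. -/
noncomputable def ServerState.handle [LinearOrder W] (x : ServerState W R S V) (p : Proc W R S)
    (m : Request W V) : ServerState W R S V × Option (Reply W V) :=
  match x.status with
  | .active =>
    match m, p with
    | .queryTag, _ => (x, some (.tag x.tloc))
    | .queryTagData, _ => (x, some (.tagData x.tloc x.vloc))
    | .repairTagData, _ => (x, some (.tagData x.tloc x.vloc))
    | .putData t v, .client c =>
        ({ x with
            tloc := if x.tloc < t then t else x.tloc
            vloc := if x.tloc < t then v else x.vloc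
            seen := x.seen ∪ {(t, c)} }, some .ack)
    | .confirmData t, .client c =>
        if (t, c) ∈ x.seen then ({ x with seen := x.seen \ {(t, c)} }, some .ack) else (x, none)
    | _, _ => (x, none)
  | _ => (x, none)

/-- The request `m` of `p` reaches server `s`. -/
noncomputable def Config.deliverReq [LinearOrder W] (σ : Config W R S V) (p : Proc W R S)
    (k : ℕ) (s : S) (m : Request W V) : Config W R S V :=
  let res := (σ.server s).handle p m
  { σ.setServer s res.1 with
    net := (σ.net \ {Msg.req p k s m}) ∪ {x | ∃ b, res.2 = some b ∧ x = Msg.rep s k p b} }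

/-- The response `b` of server `s` reaches the process that it is sent to. -/
noncomputable def Config.deliverRep (σ : Config W R S V) (s : S) (k : ℕ) (p : Proc W R S)
    (b : Reply W V) : Config W R S V :=
  let σ' : Config W R S V := { σ with net := σ.net \ {Msg.rep s k p b} }
  match p with
  | .client c => σ'.setClient c ((σ.client c).recv s k b)
  | .server s' => σ'.setServer s' ((σ.server s').recv s k b)

open Classical in
/-- The steps of the algorithm, of the links, and of the environment (invocations, failures, crashes
and repair triggers). -/
inductive Step [Fintype S] [LinearOrder W] (t₀ : Tag W) (v₀ : V) :
    Config W R S V → Label W R V → Config W R S V → Prop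
  /-- A writer without pending operation invokes `write(v)` and starts *get-tag*. -/
  | invWrite (σ : Config W R S V) (w : W) (v : V) (D : Finset S)
      (h : σ.client (.writer w) = .idle) :
      Step t₀ v₀ σ (.invWrite w v)
        (σ.clientSend (.writer w) .queryTag D (.getTag v σ.nextId fun _ => none))
  /-- A reader without pending operation invokes a read and starts *get-data*. -/
  | invRead (σ : Config W R S V) (r : R) (D : Finset S)
      (h : σ.client (.reader r) = .idle) :
      Step t₀ v₀ σ (.invRead r)
        (σ.clientSend (.reader r) .queryTagData D (.getData σ.nextId fun _ => none))
  /-- A writer with a majority of tags starts *put-data* with the tag `(t.z + 1, w)`, where `t` is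
  the largest of them. -/
  | writerPut (σ : Config W R S V) (w : W) (v : V) (k : ℕ) (resp : S → Option (Tag W))
      (t : Tag W) (D : Finset S)
      (h : σ.client (.writer w) = .getTag v k resp)
      (hmaj : Majority (responders resp))
      (hmem : ∃ s, resp s = some t) (hmax : ∀ s t', resp s = some t' → t' ≤ t) :
      Step t₀ v₀ σ .internal
        (σ.clientSend (.writer w) (.putData (toLex ((ofLex t).1 + 1, w)) v) D
          (.putData σ.nextId (toLex ((ofLex t).1 + 1, w)) v ∅))
  /-- A reader with responses from a majority starts *put-data* with the pair of largest tag. -/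
  | readerPut (σ : Config W R S V) (r : R) (k : ℕ) (resp : S → Option (Tag W × V))
      (t : Tag W) (v : V) (D : Finset S)
      (h : σ.client (.reader r) = .getData k resp)
      (hmaj : Majority (responders resp)) (hmax : IsMaxResp resp t v) :
      Step t₀ v₀ σ .internal
        (σ.clientSend (.reader r) (.putData t v) D (.putData σ.nextId t v ∅))
  /-- A client with enough acks for *put-data* starts *confirm-data*. -/
  | confirm (σ : Config W R S V) (c : Client W R) (k : ℕ) (t : Tag W) (v : V) (acks : Finset S)
      (D : Finset S)
      (h : σ.client c = .putData k t v acks)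
      (hq : ⌈(3 * (Fintype.card S : ℚ) + 1) / 4⌉₊ ≤ acks.card) :
      Step t₀ v₀ σ .internal
        (σ.clientSend c (.confirmData t) D (.confirm σ.nextId t v acks ∅))
  /-- A write terminates after *confirm-data* acks from a majority, all of it within `Sα`. -/
  | respWrite (σ : Config W R S V) (w : W) (k : ℕ) (t : Tag W) (v : V) (Sα acks : Finset S)
      (h : σ.client (.writer w) = .confirm k t v Sα acks)
      (hmaj : Majority (acks ∩ Sα)) :
      Step t₀ v₀ σ (.respWrite w) (σ.setClient (.writer w) .idle)
  /-- A read returns after *confirm-data* acks from a majority, all of it within `Sα`. -/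
  | respRead (σ : Config W R S V) (r : R) (k : ℕ) (t : Tag W) (v : V) (Sα acks : Finset S)
      (h : σ.client (.reader r) = .confirm k t v Sα acks)
      (hmaj : Majority (acks ∩ Sα)) :
      Step t₀ v₀ σ (.respRead r v) (σ.setClient (.reader r) .idle)
  /-- A client may fail at any point; it takes no step afterwards. -/
  | fail (σ : Config W R S V) (c : Client W R) :
      Step t₀ v₀ σ .internal (σ.setClient c .failed)
  /-- A message in transit reaches a server. -/
  | recvReq (σ : Config W R S V) (p : Proc W R S) (k : ℕ) (s : S) (m : Request W V)
      (h : Msg.req p k s m ∈ σ.net) :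
      Step t₀ v₀ σ .internal (σ.deliverReq p k s m)
  /-- A response in transit reaches its destination. -/
  | recvRep (σ : Config W R S V) (s : S) (k : ℕ) (p : Proc W R S) (b : Reply W V)
      (h : Msg.rep s k p b ∈ σ.net) :
      Step t₀ v₀ σ .internal (σ.deliverRep s k p b)
  /-- A server in the active or in the repair state crashes and loses all its variables. -/
  | crash (σ : Config W R S V) (s : S) (h : (σ.server s).status ≠ .crashed) :
      Step t₀ v₀ σ .internal (σ.setServer s (ServerState.default t₀ v₀ .crashed))
  /-- *init-repair* is triggered at a crashed server. The server enters the repair state, or crashes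
  again after having sent to the servers in `D` only. -/
  | initRepair (σ : Config W R S V) (s : S) (D : Finset S)
      (h : (σ.server s).status = .crashed) :
      Step t₀ v₀ σ .internal
        ((σ.groupSend (.server s) .repairTagData D).setServer s
          (ServerState.default t₀ v₀
            (if D = Finset.univ then .repair σ.nextId fun _ => none else .crashed)))
  /-- A server with repair responses from a majority adopts the pair of largest tag and becomes
  active. -/
  | endRepair (σ : Config W R S V) (s : S) (k : ℕ) (resp : S → Option (Tag W × V))
      (t : Tag W) (v : V)
      (h : (σ.server s).status = .repair k resp)
      (hmaj : Majority (responders resp)) (hmax : IsMaxResp resp t v) :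
      Step t₀ v₀ σ .internal
        (σ.setServer s { σ.server s with status := .active, tloc := t, vloc := v })

end Algorithm

/-- Executions, finite or infinite: a finite execution is continued by idle steps for ever. Time is
the index of the step; step `i` leads from `cfg i` to `cfg (i + 1)`. -/
structure Execution (W R S V : Type*) [Fintype S] [LinearOrder W] (t₀ : Tag W) (v₀ : V) where
  cfg : ℕ → Config W R S V
  label : ℕ → Label W R V
  init : cfg 0 = Config.init t₀ v₀
  step : ∀ i, Step t₀ v₀ (cfg i) (label i) (cfg (i + 1)) ∨
    (label i = .internal ∧ cfg (i + 1) = cfg i)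

section Atomicity

variable {W R V : Type*}

/-- The client at which an operation is invoked. -/
def Label.invClient : Label W R V → Option (Client W R)
  | .invWrite w _ => some (.writer w)
  | .invRead r => some (.reader r)
  | _ => none

/-- The client at which an operation responds. -/
def Label.respClient : Label W R V → Option (Client W R)
  | .respWrite w => some (.writer w)
  | .respRead r _ => some (.reader r)
  | _ => none

/-- An operation is named by the index of its invocation. -/
def IsOp (h : ℕ → Label W R V) (i : ℕ) : Prop := ∃ c, (h i).invClient = some c

/-- Operation `i` is a write. -/
def IsWrite (h : ℕ → Label W R V) (i : ℕ) : Prop := ∃ w v, h i = .invWrite w v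

/-- Operation `i` is complete, with response step `j`: the first response after `i` at the client
of `i`. -/
def CompletesAt (h : ℕ → Label W R V) (i j : ℕ) : Prop :=
  i < j ∧ ∃ c, (h i).invClient = some c ∧ (h j).respClient = some c ∧
    ∀ k, i < k → k < j → (h k).respClient ≠ some c

/-- `v` is the value of the register just before the serialization point of `i`, when the operations
in `L` take effect at their points: the value of the last write in `L` before it, or the initial
value if there is none. -/
def ValueBefore (v₀ : V) (h : ℕ → Label W R V) (L : Set ℕ) (pt : ℕ → ℝ) (i : ℕ) (v : V) : Prop :=
  (∃ k ∈ L, (∃ w, h k = .invWrite w v) ∧ pt k < pt i ∧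
    ∀ k' ∈ L, IsWrite h k' → pt k' < pt i → pt k' ≤ pt k) ∨
  (v = v₀ ∧ ∀ k' ∈ L, IsWrite h k' → ¬ pt k' < pt i)

/-- Atomicity of a history of a read/write register with initial value `v₀`: there are a set `L`
made up of all complete and some of the incomplete operations, and distinct serialization points for
the operations in `L`, each after the invocation and before the response (if any) of its operation,
such that every complete read returns the value of the register at its point. -/
def Atomic (v₀ : V) (h : ℕ → Label W R V) : Prop :=
  ∃ (L : Set ℕ) (pt : ℕ → ℝ),
    (∀ i ∈ L, IsOp h i) ∧
    (∀ i j, CompletesAt h i j → i ∈ L) ∧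
    Set.InjOn pt L ∧
    (∀ i ∈ L, (i : ℝ) < pt i) ∧
    (∀ i j, CompletesAt h i j → pt i < (j : ℝ)) ∧
    (∀ i j r v, CompletesAt h i j → h i = .invRead r → h j = .respRead r v →
      ValueBefore v₀ h L pt i v)

end Atomicity

end RadonS

/-! The tag of an operation is the one it sends in put-data. Everything rests on one fact: a
complete operation with tag `t` invoked a confirm phase at whose start a whole majority of servers
was active with tags at least `t` at the same moment (`SafeIn`). Acks of put-data alone would not
show this, since a server may crash and be repaired between its ack and those of the others.

Why it holds (`Config.Confirms.step`): a confirm ack from `s` requires `(t, c)` in `Seen`. A crash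
empties `Seen`, and only a put-data request for `t` from `c` can refill it. A server in `Sα` has
already acknowledged that request, so it is no longer in transit to `s` when the confirm phase
starts. Hence `(t, c)` was in `Seen` at that start, and `s` was active with a tag at least `t`. If
an earlier operation of `c` left put-data requests or `Seen` entries for the same `t`, as when a
reader reads one value twice, that operation was complete and `t` is safe already.

Safety persists (`Config.Locked.step`): a member of such a majority `Q` that crashes later is
repaired by a later query, whose responding majority meets `Q`; by induction over steps that member
answered with a tag at least `t`. The same intersection argument shows that operations invoked later
obtain a tag at least `t`, and a larger one if they are writes (`HasTag.ge_of_safe`).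

So tags respect real time, and values travel with their tags (`pairs_written`). Ordering operations
by tag, writes before reads, then by invocation, yields the serialization (`atomic_of_tags`). In an
infinite execution this order must still be realized by real points inside the operation intervals,
which `exists_points` does. -/

namespace RadonS

/-! ### Effect of one step on a single client, a single server and the network -/

section Components

variable {W R S V : Type*}

/-- The step from `σ` to `σ'` is the start of the *put-data* phase of client `c` with `(t, v)`. -/
inductive PutStep [Fintype S] [LinearOrder W] (σ σ' : Config W R S V) :
    Client W R → Tag W → V → Prop
  | writer (w : W) (v : V) (k : ℕ) (resp : S → Option (Tag W)) (t : Tag W) (D : Finset S)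
      (h : σ.client (.writer w) = .getTag v k resp)
      (hmaj : Majority (responders resp))
      (hmem : ∃ s, resp s = some t) (hmax : ∀ s t', resp s = some t' → t' ≤ t)
      (hσ' : σ' = σ.clientSend (.writer w) (.putData (toLex ((ofLex t).1 + 1, w)) v) D
          (.putData σ.nextId (toLex ((ofLex t).1 + 1, w)) v ∅)) :
      PutStep σ σ' (.writer w) (toLex ((ofLex t).1 + 1, w)) v
  | reader (r : R) (k : ℕ) (resp : S → Option (Tag W × V)) (t : Tag W) (v : V) (D : Finset S)
      (h : σ.client (.reader r) = .getData k resp)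
      (hmaj : Majority (responders resp)) (hmax : IsMaxResp resp t v)
      (hσ' : σ' = σ.clientSend (.reader r) (.putData t v) D (.putData σ.nextId t v ∅)) :
      PutStep σ σ' (.reader r) t v

open Classical in
/-- The ways in which the state of client `c` may change in a step to `σ'`. -/
inductive ClientChange [Fintype S] [LinearOrder W] (σ σ' : Config W R S V)
    (c : Client W R) : Label W R V → ClientState W S V → Prop
  | same (l) (hi : l.invClient ≠ some c) (hr : l.respClient ≠ some c) :
      ClientChange σ σ' c l (σ.client c)
  | failed : ClientChange σ σ' c .internal .failed
  | invFailed (l) (hi : l.invClient = some c) (h : σ.client c = .idle) :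
      ClientChange σ σ' c l .failed
  | getTag (w : W) (v : V) (hc : c = .writer w) (h : σ.client c = .idle)
      (hn : σ.nextId < σ'.nextId) :
      ClientChange σ σ' c (.invWrite w v) (.getTag v σ.nextId fun _ => none)
  | getData (r : R) (hc : c = .reader r) (h : σ.client c = .idle)
      (hn : σ.nextId < σ'.nextId) :
      ClientChange σ σ' c (.invRead r) (.getData σ.nextId fun _ => none)
  | put (t : Tag W) (v : V) (h : PutStep σ σ' c t v) (hn : σ.nextId < σ'.nextId) :
      ClientChange σ σ' c .internal (.putData σ.nextId t v ∅)
  | confirm (k : ℕ) (t : Tag W) (v : V) (acks : Finset S) (h : σ.client c = .putData k t v acks)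
      (hn : σ.nextId < σ'.nextId) : ClientChange σ σ' c .internal (.confirm σ.nextId t v acks ∅)
  | resp (l) (k : ℕ) (t : Tag W) (v : V) (Sα acks : Finset S)
      (hl : l.respClient = some c) (hv : ∀ r v', l = .respRead r v' → v' = v)
      (h : σ.client c = .confirm k t v Sα acks) (hmaj : Majority (acks ∩ Sα)) :
      ClientChange σ σ' c l .idle
  | recv (s : S) (k : ℕ) (b : Reply W V) (h : Msg.rep s k (.client c) b ∈ σ.net) :
      ClientChange σ σ' c .internal ((σ.client c).recv s k b)

/-- The ways in which the state of server `s` may change in a step to `σ'`. -/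
inductive ServerChange [Fintype S] [LinearOrder W] (t₀ : Tag W) (v₀ : V) (σ σ' : Config W R S V)
    (s : S) : ServerState W R S V → Prop
  | same : ServerChange t₀ v₀ σ σ' s (σ.server s)
  | handle (p : Proc W R S) (k : ℕ) (m : Request W V) (h : Msg.req p k s m ∈ σ.net) :
      ServerChange t₀ v₀ σ σ' s ((σ.server s).handle p m).1
  | recv (s' : S) (k : ℕ) (b : Reply W V) (h : Msg.rep s' k (.server s) b ∈ σ.net) :
      ServerChange t₀ v₀ σ σ' s ((σ.server s).recv s' k b)
  | crash : ServerChange t₀ v₀ σ σ' s (ServerState.default t₀ v₀ .crashed)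
  | initRepair (hn : σ.nextId < σ'.nextId) :
      ServerChange t₀ v₀ σ σ' s (ServerState.default t₀ v₀ (.repair σ.nextId fun _ => none))
  | endRepair (k : ℕ) (resp : S → Option (Tag W × V)) (t : Tag W) (v : V)
      (h : (σ.server s).status = .repair k resp)
      (hmaj : Majority (responders resp)) (hmax : IsMaxResp resp t v) :
      ServerChange t₀ v₀ σ σ' s { σ.server s with status := .active, tloc := t, vloc := v }

theorem Config.clientSend_client [Fintype S] (σ : Config W R S V) (c : Client W R)
    (m : Request W V) (D : Finset S) (x : ClientState W S V) :
    (σ.clientSend c m D x).client c = x ∨ (σ.clientSend c m D x).client c = .failed := by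
  classical
  by_cases h : D = Finset.univ <;> simp [Config.clientSend, Config.setClient, h]

variable [Fintype S] [LinearOrder W] {t₀ : Tag W} {v₀ : V} {σ σ' : Config W R S V}
  {l : Label W R V}

/-- This, `Step.serverChange` and the lemmas on `net` isolate what a step can do to one component,
so that invariants are checked locally instead of by cases on all global steps. -/
theorem Step.clientChange (h : Step t₀ v₀ σ l σ') (c : Client W R) :
    ClientChange σ σ' c l (σ'.client c) := by
  classical
  have key : ∀ (τ : Config W R S V) c' x, τ.client = σ.client →
      (c ≠ c' → l.invClient ≠ some c ∧ l.respClient ≠ some c) →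
      (c = c' → ClientChange σ σ' c l x) → ClientChange σ σ' c l ((τ.setClient c' x).client c) := by
    intro τ c' x hτ hne heq
    by_cases hc : c = c'
    · subst hc; simpa [Config.setClient] using heq rfl
    · simp only [Config.setClient, Function.update_of_ne hc, hτ]
      exact .same _ (hne hc).1 (hne hc).2
  cases h with
  | invWrite w v D h =>
    refine key _ _ _ rfl (fun h => ?_) (fun hc => ?_)
    · simpa [Label.invClient, Label.respClient] using Ne.symm h
    · split_ifs
      · exact .getTag w v hc (hc ▸ h) (Nat.lt_succ_self _)
      · exact .invFailed _ (by simp [Label.invClient, hc]) (hc ▸ h)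
  | invRead r D h =>
    refine key _ _ _ rfl (fun h => ?_) (fun hc => ?_)
    · simpa [Label.invClient, Label.respClient] using Ne.symm h
    · split_ifs
      · exact .getData r hc (hc ▸ h) (Nat.lt_succ_self _)
      · exact .invFailed _ (by simp [Label.invClient, hc]) (hc ▸ h)
  | writerPut w v k resp t D h hmaj hmem hmax =>
    refine key _ _ _ rfl (fun _ => by simp [Label.invClient, Label.respClient]) (fun hc => ?_)
    split_ifs
    · subst hc; exact .put _ _ (.writer w v k resp t D h hmaj hmem hmax rfl) (Nat.lt_succ_self _)
    · exact .failed
  | readerPut r k resp t v D h hmaj hmax =>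
    refine key _ _ _ rfl (fun _ => by simp [Label.invClient, Label.respClient]) (fun hc => ?_)
    split_ifs
    · subst hc; exact .put _ _ (.reader r k resp t v D h hmaj hmax rfl) (Nat.lt_succ_self _)
    · exact .failed
  | confirm c' k t v acks D h hq =>
    refine key _ _ _ rfl (fun _ => by simp [Label.invClient, Label.respClient]) (fun hc => ?_)
    split_ifs
    · exact .confirm k t v acks (hc ▸ h) (Nat.lt_succ_self _)
    · exact .failed
  | respWrite w k t v Sα acks h hmaj =>
    refine key _ _ _ rfl (fun h => ?_) (fun hc => ?_)
    · simpa [Label.invClient, Label.respClient] using Ne.symm h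
    · exact .resp _ k t v Sα acks (by simp [Label.respClient, hc]) (by simp) (hc ▸ h) hmaj
  | respRead r k t v Sα acks h hmaj =>
    refine key _ _ _ rfl (fun h => ?_) (fun hc => ?_)
    · simpa [Label.invClient, Label.respClient] using Ne.symm h
    · exact .resp _ k t v Sα acks (by simp [Label.respClient, hc]) (by simp) (hc ▸ h) hmaj
  | fail c' =>
    exact key _ _ _ rfl (fun _ => by simp [Label.invClient, Label.respClient]) (fun _ => .failed)
  | recvRep s k p b h =>
    cases p with
    | client c' =>
      refine key _ _ _ rfl (fun _ => by simp [Label.invClient, Label.respClient]) (fun hc => ?_)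
      subst hc
      exact .recv s k b h
    | server s' => exact .same _ (by simp [Label.invClient]) (by simp [Label.respClient])
  | recvReq | crash | initRepair | endRepair =>
    exact .same _ (by simp [Label.invClient]) (by simp [Label.respClient])

theorem Step.serverChange (h : Step t₀ v₀ σ l σ') (s : S) :
    ServerChange t₀ v₀ σ σ' s (σ'.server s) := by
  classical
  have key : ∀ (τ : Config W R S V) s' x, τ.server = σ.server →
      (s = s' → ServerChange t₀ v₀ σ σ' s x) →
      ServerChange t₀ v₀ σ σ' s ((τ.setServer s' x).server s) := by
    intro τ s' x hτ heq
    by_cases hs : s = s'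
    · subst hs; simpa [Config.setServer] using heq rfl
    · simp only [Config.setServer, Function.update_of_ne hs, hτ]
      exact .same
  cases h with
  | recvReq p k s' m h => exact key σ _ _ rfl (fun hs => by subst hs; exact .handle p k m h)
  | recvRep s' k p b h =>
    cases p with
    | client c => exact .same
    | server s'' => exact key _ _ _ rfl (fun hs => by subst hs; exact .recv s' k b h)
  | crash s' h => exact key _ _ _ rfl (fun _ => .crash)
  | initRepair s' D h =>
    refine key _ _ _ rfl (fun _ => ?_)
    split_ifs
    · exact .initRepair (Nat.lt_succ_self _)
    -- A server that fails in the middle of its repair group-send ends in the crash state; the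
    -- requests already sent show only in the network.
    · exact .crash
  | endRepair s' k resp t v h hmaj hmax =>
    exact key _ _ _ rfl (fun hs => by subst hs; exact .endRepair k resp t v h hmaj hmax)
  | _ => exact .same

theorem Step.nextId_le (h : Step t₀ v₀ σ l σ') : σ.nextId ≤ σ'.nextId := by
  cases h with
  | recvRep s' k p b h => cases p <;> exact le_rfl
  | invWrite | invRead | writerPut | readerPut | confirm | initRepair => exact Nat.le_succ _
  | _ => exact le_rfl

/-- The requests that a step may group-send on behalf of process `p`. -/
inductive NewRequest (σ σ' : Config W R S V) : Proc W R S → Request W V → Prop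
  | queryTag (c) (h : σ.client c = .idle) : NewRequest σ σ' (.client c) .queryTag
  | queryTagData (c) (h : σ.client c = .idle) : NewRequest σ σ' (.client c) .queryTagData
  | put (c t v) (h : PutStep σ σ' c t v) : NewRequest σ σ' (.client c) (.putData t v)
  | confirm (c k t v acks) (h : σ.client c = .putData k t v acks) :
      NewRequest σ σ' (.client c) (.confirmData t)
  | repair (s) : NewRequest σ σ' (.server s) .repairTagData

/-- All requests that are new after a step carry the fresh identifier and the same content. -/
theorem Step.net_req (h : Step t₀ v₀ σ l σ') :
    ∃ m₀, ∀ p k s m, Msg.req p k s m ∈ σ'.net → Msg.req p k s m ∈ σ.net ∨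
      (k = σ.nextId ∧ σ'.nextId = σ.nextId + 1 ∧ m = m₀ ∧ NewRequest σ σ' p m) := by
  have send : ∀ p₀ m₀ (D : Finset S), σ'.nextId = σ.nextId + 1 →
      σ'.net = (σ.groupSend p₀ m₀ D).net → NewRequest σ σ' p₀ m₀ → _ :=
    fun p₀ m₀ D hid hnet hnew => show ∃ m₀, ∀ p k s m, Msg.req p k s m ∈ σ'.net →
        Msg.req p k s m ∈ σ.net ∨ (k = σ.nextId ∧ σ'.nextId = σ.nextId + 1 ∧ m = m₀ ∧
          NewRequest σ σ' p m) from by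
      refine ⟨m₀, fun p k s m hm => ?_⟩
      rw [hnet] at hm
      rcases hm with hm | ⟨s, -, hm⟩
      · exact .inl hm
      · cases hm
        exact .inr ⟨rfl, hid, rfl, hnew⟩
  cases h with
  | recvReq p' k' s' m' h =>
    refine ⟨.queryTag, fun p k s m hm => .inl ?_⟩
    simp [Config.deliverReq, Config.setServer] at hm; exact hm.1
  | recvRep s' k' p' b h =>
    refine ⟨.queryTag, fun p k s m hm => .inl ?_⟩
    cases p' <;> simp [Config.deliverRep, Config.setServer, Config.setClient] at hm <;> exact hm
  | invWrite w v D h => exact send _ _ D rfl rfl (.queryTag _ h)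
  | invRead r D h => exact send _ _ D rfl rfl (.queryTagData _ h)
  | writerPut w v k resp t D h hmaj hmem hmax =>
    exact send _ _ D rfl rfl (.put _ _ _ (.writer w v k resp t D h hmaj hmem hmax rfl))
  | readerPut r k resp t v D h hmaj hmax =>
    exact send _ _ D rfl rfl (.put _ _ _ (.reader r k resp t v D h hmaj hmax rfl))
  | confirm c k t v acks D h hq => exact send _ _ D rfl rfl (.confirm _ _ _ _ _ h)
  | initRepair s D h => exact send _ _ D rfl rfl (.repair _)
  | _ => exact ⟨.queryTag, fun p k s m hm => .inl hm⟩

theorem Step.mem_net_req (h : Step t₀ v₀ σ l σ') {p k s m} (hm : Msg.req p k s m ∈ σ'.net) :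
    Msg.req p k s m ∈ σ.net ∨
      (k = σ.nextId ∧ σ'.nextId = σ.nextId + 1 ∧ NewRequest σ σ' p m) := by
  obtain ⟨m₀, h'⟩ := h.net_req
  rcases h' _ _ _ _ hm with h' | ⟨h1, h2, -, h3⟩
  · exact .inl h'
  · exact .inr ⟨h1, h2, h3⟩

/-- A delivered request leaves the network in the very step that emits its response. Recording this
absence is what makes `Links.rep_req` inductive. -/
theorem Step.mem_net_rep (h : Step t₀ v₀ σ l σ') {p k s b} (hm : Msg.rep s k p b ∈ σ'.net) :
    Msg.rep s k p b ∈ σ.net ∨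
      ∃ m, Msg.req p k s m ∈ σ.net ∧ Msg.req p k s m ∉ σ'.net ∧
        ((σ.server s).handle p m).2 = some b := by
  cases h with
  | recvReq p' k' s' m' h =>
    simp only [Config.deliverReq, Config.setServer] at hm
    rcases hm with hm | ⟨b', hb, hm⟩
    · exact .inl hm.1
    · injection hm with h1 h2 h3 h4
      subst h1 h2 h3 h4
      exact .inr ⟨m', h, by simp [Config.deliverReq], hb⟩
  | recvRep s' k' p' b h =>
    left; cases p' <;> simp [Config.deliverRep, Config.setServer, Config.setClient] at hm <;>
      exact hm.1
  | invWrite | invRead | writerPut | readerPut | confirm | initRepair =>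
    rcases hm with hm | ⟨s, -, hm⟩
    · exact .inl hm
    · cases hm
  | _ => exact .inl hm

theorem PutStep.client_after {c t v} (h : PutStep σ σ' c t v) :
    σ'.client c = .putData σ.nextId t v ∅ ∨ σ'.client c = .failed := by
  cases h with
  | writer w v k resp t D h hmaj hmem hmax hσ' => rw [hσ']; exact Config.clientSend_client ..
  | reader r k resp t v D h hmaj hmax hσ' => rw [hσ']; exact Config.clientSend_client ..

theorem PutStep.client_before {c t v} (h : PutStep σ σ' c t v) :
    (∃ k resp, σ.client c = .getTag v k resp) ∨ ∃ k resp, σ.client c = .getData k resp := by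
  cases h with
  | writer w v k resp t D h => exact .inl ⟨_, _, h⟩
  | reader r k resp t v D h => exact .inr ⟨_, _, h⟩

/-- The client state fixes the recorded responses, and their largest tag is unique. -/
theorem PutStep.tag_unique {c t t' v v'} (h : PutStep σ σ' c t v) (h' : PutStep σ σ' c t' v') :
    t = t' := by
  cases h with
  | writer w v k resp t D h hmaj hmem hmax hσ =>
    cases h' with
    | writer _ v' k' resp' t' D' h' hmaj' hmem' hmax' hσ' =>
      rw [h] at h'
      cases h'
      obtain ⟨s, hs⟩ := hmem
      obtain ⟨s', hs'⟩ := hmem'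
      rw [le_antisymm (hmax' _ _ hs) (hmax _ _ hs')]
  | reader r k resp t v D h hmaj hmax hσ =>
    cases h' with
    | reader _ k' resp' t' v' D' h' hmaj' hmax' hσ' =>
      rw [h] at h'
      cases h'
      obtain ⟨s, hs⟩ := hmax.1
      obtain ⟨s', hs'⟩ := hmax'.1
      exact le_antisymm (hmax'.2 _ _ _ hs) (hmax.2 _ _ _ hs')

end Components

/-! ### Inversion of the message handlers of clients and servers -/

section Reactions

variable {W R S V : Type*}

/-- A receipt never changes the phase or its identifier, so the phase can be read backwards: each
recorded response is old or is the message just delivered. The other `recv_eq` lemmas serve the same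
purpose. -/
theorem ClientState.recv_eq_getTag {st : ClientState W S V} {s k b v k' resp}
    (h : st.recv s k b = .getTag v k' resp) :
    ∃ resp', st = .getTag v k' resp' ∧ ∀ s' t, resp s' = some t →
      resp' s' = some t ∨ (s' = s ∧ k = k' ∧ b = .tag t) := by
  classical
  unfold ClientState.recv at h
  split at h
  · split_ifs at h with hk
    · cases h
      refine ⟨_, rfl, fun s' t ht => ?_⟩
      by_cases hs : s' = s
      · subst hs; simp_all
      · rw [Function.update_of_ne hs] at ht; exact .inl ht
    · exact ⟨resp, h, fun _ _ ht => .inl ht⟩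
  all_goals try split_ifs at h
  all_goals exact ⟨resp, h, fun _ _ ht => .inl ht⟩

theorem ClientState.recv_eq_getData {st : ClientState W S V} {s k b k' resp}
    (h : st.recv s k b = .getData k' resp) :
    ∃ resp', st = .getData k' resp' ∧ ∀ s' t v, resp s' = some (t, v) →
      resp' s' = some (t, v) ∨ (s' = s ∧ k = k' ∧ b = .tagData t v) := by
  classical
  unfold ClientState.recv at h
  split at h
  · split_ifs at h
  · split_ifs at h with hk
    · cases h
      refine ⟨_, rfl, fun s' t v ht => ?_⟩
      by_cases hs : s' = s
      · subst hs; simp_all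
      · rw [Function.update_of_ne hs] at ht; exact .inl ht
    · exact ⟨resp, h, fun _ _ _ ht => .inl ht⟩
  all_goals try split_ifs at h
  all_goals exact ⟨resp, h, fun _ _ _ ht => .inl ht⟩

theorem ClientState.recv_eq_putData {st : ClientState W S V} {s k b k' t v acks}
    (h : st.recv s k b = .putData k' t v acks) :
    ∃ acks', st = .putData k' t v acks' ∧ ∀ s' ∈ acks,
      s' ∈ acks' ∨ (s' = s ∧ k = k' ∧ b = .ack) := by
  classical
  unfold ClientState.recv at h
  split at h
  · split_ifs at h
  · split_ifs at h
  · split_ifs at h with hk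
    · cases h
      refine ⟨_, rfl, fun s' hs => ?_⟩
      rcases Finset.mem_insert.1 hs with hs | hs
      · exact .inr ⟨hs, hk, rfl⟩
      · exact .inl hs
    · exact ⟨acks, h, fun _ h => .inl h⟩
  · split_ifs at h
  · exact ⟨acks, h, fun _ h => .inl h⟩

theorem ClientState.recv_eq_confirm {st : ClientState W S V} {s k b k' t v Sα acks}
    (h : st.recv s k b = .confirm k' t v Sα acks) :
    ∃ acks', st = .confirm k' t v Sα acks' ∧ ∀ s' ∈ acks,
      s' ∈ acks' ∨ (s' = s ∧ k = k' ∧ b = .ack) := by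
  classical
  unfold ClientState.recv at h
  split at h
  · split_ifs at h
  · split_ifs at h
  · split_ifs at h
  · split_ifs at h with hk
    · cases h
      refine ⟨_, rfl, fun s' hs => ?_⟩
      rcases Finset.mem_insert.1 hs with hs | hs
      · exact .inr ⟨hs, hk, rfl⟩
      · exact .inl hs
    · exact ⟨acks, h, fun _ h => .inl h⟩
  · exact ⟨acks, h, fun _ h => .inl h⟩

theorem ClientState.recv_eq_idle {st : ClientState W S V} {s k b}
    (h : st.recv s k b = .idle) : st = .idle := by
  unfold ClientState.recv at h
  split at h <;> try split_ifs at h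
  all_goals exact h

theorem ServerState.recv_fields (x : ServerState W R S V) (s k b) :
    (x.recv s k b).tloc = x.tloc ∧ (x.recv s k b).vloc = x.vloc ∧ (x.recv s k b).seen = x.seen ∧
    ((x.recv s k b).status = .active ↔ x.status = .active) := by
  unfold ServerState.recv
  split
  · split_ifs
    · simp_all
    · simp
  · simp

theorem ServerState.recv_eq_repair {x : ServerState W R S V} {s k b k' resp}
    (h : (x.recv s k b).status = .repair k' resp) :
    ∃ resp', x.status = .repair k' resp' ∧ ∀ s' t v, resp s' = some (t, v) →
      resp' s' = some (t, v) ∨ (s' = s ∧ k = k' ∧ b = .tagData t v) := by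
  classical
  unfold ServerState.recv at h
  split at h
  · rename_i hx
    split_ifs at h with hk
    · cases h
      refine ⟨_, hx, fun s' t v ht => ?_⟩
      by_cases hs : s' = s
      · subst hs; simp_all
      · rw [Function.update_of_ne hs] at ht; exact .inl ht
    · exact ⟨resp, h, fun _ _ _ ht => .inl ht⟩
  · exact ⟨resp, h, fun _ _ _ ht => .inl ht⟩

variable [LinearOrder W]

theorem ServerState.handle_status (x : ServerState W R S V) (p m) :
    (x.handle p m).1.status = x.status := by
  unfold ServerState.handle
  split
  · split <;> try split_ifs
    all_goals rfl
  · rfl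

theorem ServerState.le_handle_tloc (x : ServerState W R S V) (p m) :
    x.tloc ≤ (x.handle p m).1.tloc := by
  unfold ServerState.handle
  split
  · split <;> try split_ifs
    all_goals first | exact le_rfl | exact le_of_lt ‹_›
  · exact le_rfl

/-- The stored pair after handling a request is the old one, or was sent by that request. -/
theorem ServerState.handle_pair (x : ServerState W R S V) (p m) :
    ((x.handle p m).1.tloc = x.tloc ∧ (x.handle p m).1.vloc = x.vloc) ∨
      m = .putData (x.handle p m).1.tloc (x.handle p m).1.vloc := by
  unfold ServerState.handle
  split
  · split <;> try split_ifs
    all_goals first | exact .inl ⟨rfl, rfl⟩ | exact .inr rfl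
  · exact .inl ⟨rfl, rfl⟩

theorem ServerState.handle_reply {x : ServerState W R S V} {p m b}
    (h : (x.handle p m).2 = some b) :
    x.status = .active ∧ (b = .tag x.tloc ∨ b = .tagData x.tloc x.vloc ∨ b = .ack) := by
  unfold ServerState.handle at h
  split at h
  · rename_i hx
    refine ⟨hx, ?_⟩
    split at h <;> try split_ifs at h
    all_goals simp_all
  · cases h

/-- A positive acknowledgement answers a *put-data* request, or a *confirm-data* request for a pair
that has been seen. -/
theorem ServerState.handle_ack {x : ServerState W R S V} {c : Client W R} {m}
    (h : (x.handle (.client c) m).2 = some .ack) :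
    (∃ t v, m = .putData t v) ∨ ∃ t, m = .confirmData t ∧ (t, c) ∈ x.seen := by
  unfold ServerState.handle at h
  split at h
  · split at h <;> try split_ifs at h
    all_goals simp_all
  · cases h

/-- Only put-data adds to `Seen`, and it raises the stored tag to at least the one it brings. This
is why an entry of `Seen` certifies the tag of the server. -/
theorem ServerState.handle_seen {x : ServerState W R S V} {p m t c}
    (h : (t, c) ∈ (x.handle p m).1.seen) :
    (t, c) ∈ x.seen ∨ (x.status = .active ∧ t ≤ (x.handle p m).1.tloc ∧
      p = .client c ∧ ∃ v, m = .putData t v) := by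
  unfold ServerState.handle at h ⊢
  split at h
  · rename_i hx
    split at h <;> try split_ifs at h
    all_goals first | exact .inl h | exact .inl h.1 | skip
    all_goals
      rcases h with h | h
      · exact .inl h
      · cases h
        refine .inr ⟨hx, ?_, rfl, _, rfl⟩
        simp only
        split_ifs
        first | exact le_rfl | exact not_lt.1 ‹_›
  · exact .inl h

end Reactions

/-! ### Persistence of a tag once a majority holds it -/

section Locking

variable {W R S V : Type*} [Fintype S] [LinearOrder W]

set_option linter.unusedSectionVars false

theorem Majority.inter {P Q : Finset S} (hP : Majority P) (hQ : Majority Q) : ∃ s ∈ P, s ∈ Q := by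
  classical
  by_contra! h
  have hd : Disjoint P Q := Finset.disjoint_left.2 h
  have := Finset.card_le_univ (P ∪ Q)
  rw [Finset.card_union_of_disjoint hd] at this
  unfold Majority at hP hQ
  omega

theorem exists_resp_of_majority {A : Type*} {Q : Finset S} (hQ : Majority Q) {resp : S → Option A}
    (h : Majority (responders resp)) : ∃ s ∈ Q, ∃ a, resp s = some a := by
  obtain ⟨s, h1, h2⟩ := h.inter hQ
  exact ⟨s, h2, Option.isSome_iff_exists.1 (by simpa [responders] using h1)⟩

/-- All identifiers in use are below `nextId`. -/
structure Config.IdsBelow (σ : Config W R S V) : Prop where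
  req : ∀ p k s m, Msg.req p k s m ∈ σ.net → k < σ.nextId
  rep : ∀ s k p b, Msg.rep s k p b ∈ σ.net → k < σ.nextId
  getTag : ∀ c v k resp, σ.client c = .getTag v k resp → k < σ.nextId
  getData : ∀ c k resp, σ.client c = .getData k resp → k < σ.nextId
  putData : ∀ c k t v acks, σ.client c = .putData k t v acks → k < σ.nextId
  confirm : ∀ c k t v Sα acks, σ.client c = .confirm k t v Sα acks → k < σ.nextId
  repair : ∀ s k resp, (σ.server s).status = .repair k resp → k < σ.nextId

/-- The tag `t` is locked in by the quorum `Q`: its members hold tags at least `t` whenever they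
are active, and answer so to every group-send whose identifier is at least `K`. -/
structure Config.Locked (Q : Finset S) (t : Tag W) (K : ℕ) (σ : Config W R S V) : Prop where
  id_le : K ≤ σ.nextId
  active : ∀ s ∈ Q, (σ.server s).status = .active → t ≤ (σ.server s).tloc
  repair : ∀ s ∈ Q, ∀ k resp, (σ.server s).status = .repair k resp → K ≤ k
  repairResp : ∀ s' k resp, (σ.server s').status = .repair k resp → K ≤ k →
    ∀ s ∈ Q, ∀ t' v', resp s = some (t', v') → t ≤ t'
  getTag : ∀ c v k resp, σ.client c = .getTag v k resp → K ≤ k →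
    ∀ s ∈ Q, ∀ t', resp s = some t' → t ≤ t'
  getData : ∀ c k resp, σ.client c = .getData k resp → K ≤ k →
    ∀ s ∈ Q, ∀ t' v', resp s = some (t', v') → t ≤ t'
  repTag : ∀ s ∈ Q, ∀ k p t', Msg.rep s k p (.tag t') ∈ σ.net → K ≤ k → t ≤ t'
  repTagData : ∀ s ∈ Q, ∀ k p t' v', Msg.rep s k p (.tagData t' v') ∈ σ.net → K ≤ k → t ≤ t'

/-- Server `s` is active with a tag at least `t`. -/
def Config.Holds (σ : Config W R S V) (t : Tag W) (s : S) : Prop :=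
  (σ.server s).status = .active ∧ t ≤ (σ.server s).tloc

variable {t₀ : Tag W} {v₀ : V} {σ σ' : Config W R S V} {l : Label W R V}

theorem Config.IdsBelow.init : (Config.init t₀ v₀ : Config W R S V).IdsBelow := by
  constructor <;> simp [Config.init, ServerState.default]

theorem Config.IdsBelow.step (hσ : σ.IdsBelow) (h : Step t₀ v₀ σ l σ') : σ'.IdsBelow := by
  have hle := h.nextId_le
  refine ⟨?_, ?_, ?_, ?_, ?_, ?_, ?_⟩
  · intro p k s m hm
    rcases h.mem_net_req hm with h' | ⟨rfl, h', -⟩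
    · exact (hσ.req _ _ _ _ h').trans_le hle
    · omega
  · intro s k p b hm
    rcases h.mem_net_rep hm with h' | ⟨m, h', -, -⟩
    · exact (hσ.rep _ _ _ _ h').trans_le hle
    · exact (hσ.req _ _ _ _ h').trans_le hle
  · intro c v k resp hk
    have hc := h.clientChange c
    generalize σ'.client c = x at hc hk
    cases hc with
    | same => exact (hσ.getTag _ _ _ _ hk).trans_le hle
    | getTag => cases hk; assumption
    | recv s k b hm =>
      obtain ⟨_, h, -⟩ := ClientState.recv_eq_getTag hk
      exact (hσ.getTag _ _ _ _ h).trans_le hle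
    | _ => cases hk
  · intro c k resp hk
    have hc := h.clientChange c
    generalize σ'.client c = x at hc hk
    cases hc with
    | same => exact (hσ.getData _ _ _ hk).trans_le hle
    | getData => cases hk; assumption
    | recv s k b hm =>
      obtain ⟨_, h, -⟩ := ClientState.recv_eq_getData hk
      exact (hσ.getData _ _ _ h).trans_le hle
    | _ => cases hk
  · intro c k t v acks hk
    have hc := h.clientChange c
    generalize σ'.client c = x at hc hk
    cases hc with
    | same => exact (hσ.putData _ _ _ _ _ hk).trans_le hle
    | put => cases hk; assumption
    | recv s k b hm =>
      obtain ⟨_, h, -⟩ := ClientState.recv_eq_putData hk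
      exact (hσ.putData _ _ _ _ _ h).trans_le hle
    | _ => cases hk
  · intro c k t v Sα acks hk
    have hc := h.clientChange c
    generalize σ'.client c = x at hc hk
    cases hc with
    | same => exact (hσ.confirm _ _ _ _ _ _ hk).trans_le hle
    | confirm => cases hk; assumption
    | recv s k b hm =>
      obtain ⟨_, h, -⟩ := ClientState.recv_eq_confirm hk
      exact (hσ.confirm _ _ _ _ _ _ h).trans_le hle
    | _ => cases hk
  · intro s k resp hk
    have hc := h.serverChange s
    generalize σ'.server s = x at hc hk
    cases hc with
    | same => exact (hσ.repair _ _ _ hk).trans_le hle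
    | handle p k m _ =>
      rw [ServerState.handle_status] at hk
      exact (hσ.repair _ _ _ hk).trans_le hle
    | recv s'' k b hm =>
      obtain ⟨_, h, -⟩ := ServerState.recv_eq_repair hk
      exact (hσ.repair _ _ _ h).trans_le hle
    | initRepair => cases hk; assumption
    | _ => cases hk

/-- With `K = nextId` no group-send with identifier at least `K` exists yet, so the clauses on
responses are vacuous; the clause on repairs is vacuous because all of `Q` is active. -/
theorem Config.Locked.of_holds (hσ : σ.IdsBelow) {Q : Finset S} {t : Tag W}
    (h : ∀ s ∈ Q, σ.Holds t s) : σ.Locked Q t σ.nextId where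
  id_le := le_rfl
  active s hs _ := (h s hs).2
  repair s hs k resp hk := by rw [(h s hs).1] at hk; cases hk
  repairResp s k resp hk hle := absurd (hσ.repair _ _ _ hk) hle.not_gt
  getTag c v k resp hk hle := absurd (hσ.getTag _ _ _ _ hk) hle.not_gt
  getData c k resp hk hle := absurd (hσ.getData _ _ _ hk) hle.not_gt
  repTag s _ k p t hk hle := absurd (hσ.rep _ _ _ _ hk) hle.not_gt
  repTagData s _ k p t v hk hle := absurd (hσ.rep _ _ _ _ hk) hle.not_gt

/-- The members of `Q` may all crash and be repaired from one another. This is not circular, since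
responses in transit or recorded are part of the invariant: each was sent by a then active member of
`Q`, at an earlier step. -/
theorem Config.Locked.step {Q : Finset S} {t : Tag W} {K : ℕ} (hQ : Majority Q)
    (hσ : σ.Locked Q t K) (h : Step t₀ v₀ σ l σ') : σ'.Locked Q t K := by
  refine ⟨hσ.id_le.trans h.nextId_le, ?_, ?_, ?_, ?_, ?_, ?_, ?_⟩
  · intro s hs hact
    have hc := h.serverChange s
    generalize σ'.server s = x at hc hact
    cases hc with
    | same => exact hσ.active s hs hact
    | handle p k m _ =>
      rw [ServerState.handle_status] at hact
      exact (hσ.active s hs hact).trans (ServerState.le_handle_tloc _ _ _)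
    | recv s' k b _ =>
      obtain ⟨h1, -, -, h2⟩ := ServerState.recv_fields (σ.server s) s' k b
      rw [h1]
      exact hσ.active s hs (h2.1 hact)
    | crash => cases hact
    | initRepair => cases hact
    -- The repair of a member of `Q` has identifier at least `K`, so the response from a member `s'`
    -- of `Q` among the responders bounds the adopted maximum from below.
    | endRepair k resp t' v' hk hmaj hmax =>
      obtain ⟨s', hs', ⟨t'', v''⟩, ha⟩ := exists_resp_of_majority hQ hmaj
      exact (hσ.repairResp _ _ _ hk (hσ.repair s hs _ _ hk) s' hs' _ _ ha).trans (hmax.2 _ _ _ ha)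
  · intro s hs k resp hk
    have hc := h.serverChange s
    generalize σ'.server s = x at hc hk
    cases hc with
    | same => exact hσ.repair s hs _ _ hk
    | handle p k m _ =>
      rw [ServerState.handle_status] at hk
      exact hσ.repair s hs _ _ hk
    | recv s' k b _ =>
      obtain ⟨_, h, -⟩ := ServerState.recv_eq_repair hk
      exact hσ.repair s hs _ _ h
    | crash => cases hk
    | initRepair => cases hk; exact hσ.id_le
    | endRepair => cases hk
  · intro s k resp hk hle s' hs' t' v' hr
    have hc := h.serverChange s
    generalize σ'.server s = x at hc hk
    cases hc with
    | same => exact hσ.repairResp _ _ _ hk hle _ hs' _ _ hr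
    | handle p k m _ =>
      rw [ServerState.handle_status] at hk
      exact hσ.repairResp _ _ _ hk hle _ hs' _ _ hr
    | recv s'' k b hm =>
      obtain ⟨_, h, h'⟩ := ServerState.recv_eq_repair hk
      rcases h' _ _ _ hr with h' | ⟨rfl, rfl, rfl⟩
      · exact hσ.repairResp _ _ _ h hle _ hs' _ _ h'
      · exact hσ.repTagData _ hs' _ _ _ _ hm hle
    | crash => cases hk
    | initRepair => cases hk; cases hr
    | endRepair => cases hk
  · intro c v k resp hk hle s' hs' t' hr
    have hc := h.clientChange c
    generalize σ'.client c = x at hc hk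
    cases hc with
    | same => exact hσ.getTag _ _ _ _ hk hle _ hs' _ hr
    | getTag => cases hk; cases hr
    | recv s k b hm =>
      obtain ⟨_, h, h'⟩ := ClientState.recv_eq_getTag hk
      rcases h' _ _ hr with h' | ⟨rfl, rfl, rfl⟩
      · exact hσ.getTag _ _ _ _ h hle _ hs' _ h'
      · exact hσ.repTag _ hs' _ _ _ hm hle
    | _ => cases hk
  · intro c k resp hk hle s' hs' t' v' hr
    have hc := h.clientChange c
    generalize σ'.client c = x at hc hk
    cases hc with
    | same => exact hσ.getData _ _ _ hk hle _ hs' _ _ hr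
    | getData => cases hk; cases hr
    | recv s k b hm =>
      obtain ⟨_, h, h'⟩ := ClientState.recv_eq_getData hk
      rcases h' _ _ _ hr with h' | ⟨rfl, rfl, rfl⟩
      · exact hσ.getData _ _ _ h hle _ hs' _ _ h'
      · exact hσ.repTagData _ hs' _ _ _ _ hm hle
    | _ => cases hk
  · intro s hs k p t' hm hle
    rcases h.mem_net_rep hm with h' | ⟨m, -, -, h'⟩
    · exact hσ.repTag _ hs _ _ _ h' hle
    · obtain ⟨h1, h2⟩ := ServerState.handle_reply h'
      rcases h2 with h2 | h2 | h2 <;> cases h2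
      exact hσ.active s hs h1
  · intro s hs k p t' v' hm hle
    rcases h.mem_net_rep hm with h' | ⟨m, -, -, h'⟩
    · exact hσ.repTagData _ hs _ _ _ _ h' hle
    · obtain ⟨h1, h2⟩ := ServerState.handle_reply h'
      rcases h2 with h2 | h2 | h2 <;> cases h2
      exact hσ.active s hs h1

end Locking

/-! ### Propagation of tag-value pairs -/

section Values

variable {W R S V : Type*} [Fintype S] [LinearOrder W]

set_option linter.unusedSectionVars false

/-- Every pair of a tag and a value that occurs in `σ` satisfies `G`. -/
structure Config.PairsIn (G : Tag W → V → Prop) (σ : Config W R S V) : Prop where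
  server : ∀ s, G (σ.server s).tloc (σ.server s).vloc
  repair : ∀ s k resp, (σ.server s).status = .repair k resp →
    ∀ s' t v, resp s' = some (t, v) → G t v
  getTag : ∀ c v k resp, σ.client c = .getTag v k resp → ∀ s t, resp s = some t → ∃ v', G t v'
  getData : ∀ c k resp, σ.client c = .getData k resp → ∀ s t v, resp s = some (t, v) → G t v
  putData : ∀ c k t v acks, σ.client c = .putData k t v acks → G t v
  confirm : ∀ c k t v Sα acks, σ.client c = .confirm k t v Sα acks → G t v
  req : ∀ p k s t v, Msg.req p k s (.putData t v) ∈ σ.net → G t v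
  repTag : ∀ s k p t, Msg.rep s k p (.tag t) ∈ σ.net → ∃ v, G t v
  repTagData : ∀ s k p t v, Msg.rep s k p (.tagData t v) ∈ σ.net → G t v

variable {t₀ : Tag W} {v₀ : V} {σ σ' : Config W R S V} {l : Label W R V} {G : Tag W → V → Prop}

theorem Config.PairsIn.init (h : G t₀ v₀) :
    (Config.init t₀ v₀ : Config W R S V).PairsIn G := by
  constructor <;> simp [Config.init, ServerState.default, h]

/-- Servers, repairs and reads only relay existing pairs and resets reintroduce `(t₀, v₀)`, so `G`
has to be verified only where a writer creates a pair. -/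
theorem Config.PairsIn.step (hσ : σ.PairsIn G) (h₀ : G t₀ v₀)
    (hw : ∀ w t v, PutStep σ σ' (.writer w) t v → G t v) (h : Step t₀ v₀ σ l σ') :
    σ'.PairsIn G := by
  have hput : ∀ c t v, PutStep σ σ' c t v → G t v := by
    intro c t v hp
    cases c with
    | writer w => exact hw _ _ _ hp
    | reader r =>
      cases hp with
      | reader _ k resp _ _ D h hmaj hmax =>
        obtain ⟨s, hs⟩ := hmax.1
        exact hσ.getData _ _ _ h _ _ _ hs
  refine ⟨?_, ?_, ?_, ?_, ?_, ?_, ?_, ?_, ?_⟩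
  · intro s
    have hc := h.serverChange s
    generalize σ'.server s = x at hc
    cases hc with
    | same => exact hσ.server s
    | handle p k m hm =>
      rcases ServerState.handle_pair (σ.server s) p m with ⟨h1, h2⟩ | h'
      · rw [h1, h2]; exact hσ.server s
      · rw [h'] at hm; exact hσ.req _ _ _ _ _ hm
    | recv s' k b hm =>
      obtain ⟨h1, h2, -⟩ := ServerState.recv_fields (σ.server s) s' k b
      rw [h1, h2]; exact hσ.server s
    | crash => exact h₀
    | initRepair => exact h₀
    | endRepair k resp t v hk hmaj hmax =>
      obtain ⟨s', hs'⟩ := hmax.1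
      exact hσ.repair _ _ _ hk _ _ _ hs'
  · intro s k resp hk s' t v hr
    have hc := h.serverChange s
    generalize σ'.server s = x at hc hk
    cases hc with
    | same => exact hσ.repair _ _ _ hk _ _ _ hr
    | handle p k m _ =>
      rw [ServerState.handle_status] at hk
      exact hσ.repair _ _ _ hk _ _ _ hr
    | recv s'' k b hm =>
      obtain ⟨_, h, h'⟩ := ServerState.recv_eq_repair hk
      rcases h' _ _ _ hr with h' | ⟨rfl, rfl, rfl⟩
      · exact hσ.repair _ _ _ h _ _ _ h'
      · exact hσ.repTagData _ _ _ _ _ hm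
    | initRepair => cases hk; cases hr
    | _ => cases hk
  · intro c v k resp hk s' t hr
    have hc := h.clientChange c
    generalize σ'.client c = x at hc hk
    cases hc with
    | same => exact hσ.getTag _ _ _ _ hk _ _ hr
    | getTag => cases hk; cases hr
    | recv s k b hm =>
      obtain ⟨_, h, h'⟩ := ClientState.recv_eq_getTag hk
      rcases h' _ _ hr with h' | ⟨rfl, rfl, rfl⟩
      · exact hσ.getTag _ _ _ _ h _ _ h'
      · exact hσ.repTag _ _ _ _ hm
    | _ => cases hk
  · intro c k resp hk s' t v hr
    have hc := h.clientChange c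
    generalize σ'.client c = x at hc hk
    cases hc with
    | same => exact hσ.getData _ _ _ hk _ _ _ hr
    | getData => cases hk; cases hr
    | recv s k b hm =>
      obtain ⟨_, h, h'⟩ := ClientState.recv_eq_getData hk
      rcases h' _ _ _ hr with h' | ⟨rfl, rfl, rfl⟩
      · exact hσ.getData _ _ _ h _ _ _ h'
      · exact hσ.repTagData _ _ _ _ _ hm
    | _ => cases hk
  · intro c k t v acks hk
    have hc := h.clientChange c
    generalize σ'.client c = x at hc hk
    cases hc with
    | same => exact hσ.putData _ _ _ _ _ hk
    | put _ _ hp => cases hk; exact hput _ _ _ hp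
    | recv s k b hm =>
      obtain ⟨_, h, -⟩ := ClientState.recv_eq_putData hk
      exact hσ.putData _ _ _ _ _ h
    | _ => cases hk
  · intro c k t v Sα acks hk
    have hc := h.clientChange c
    generalize σ'.client c = x at hc hk
    cases hc with
    | same => exact hσ.confirm _ _ _ _ _ _ hk
    | confirm _ _ _ _ h => cases hk; exact hσ.putData _ _ _ _ _ h
    | recv s k b hm =>
      obtain ⟨_, h, -⟩ := ClientState.recv_eq_confirm hk
      exact hσ.confirm _ _ _ _ _ _ h
    | _ => cases hk
  · intro p k s t v hm
    rcases h.mem_net_req hm with h' | ⟨-, -, h'⟩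
    · exact hσ.req _ _ _ _ _ h'
    · cases h' with
      | put c _ _ hp => exact hput _ _ _ hp
  · intro s k p t hm
    rcases h.mem_net_rep hm with h' | ⟨m, -, -, h'⟩
    · exact hσ.repTag _ _ _ _ h'
    · obtain ⟨-, h2⟩ := ServerState.handle_reply h'
      rcases h2 with h2 | h2 | h2 <;> cases h2
      exact ⟨_, hσ.server s⟩
  · intro s k p t v hm
    rcases h.mem_net_rep hm with h' | ⟨m, -, -, h'⟩
    · exact hσ.repTagData _ _ _ _ _ h'
    · obtain ⟨-, h2⟩ := ServerState.handle_reply h'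
      rcases h2 with h2 | h2 | h2 <;> cases h2
      exact hσ.server s

end Values

/-! ### Confirmed tags were held by a majority simultaneously -/

section Confirmation

variable {W R S V : Type*} [Fintype S] [LinearOrder W]

set_option linter.unusedSectionVars false

/-- In some configuration of `P`, a majority holds a tag at least `t`. -/
def SafeIn (P : Set (Config W R S V)) (t : Tag W) : Prop :=
  ∃ τ ∈ P, ∃ Q : Finset S, Majority Q ∧ ∀ s ∈ Q, τ.Holds t s

theorem SafeIn.mono {P P' : Set (Config W R S V)} (hP : P ⊆ P') {t : Tag W} (h : SafeIn P t) :
    SafeIn P' t :=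
  let ⟨τ, hτ, h⟩ := h
  ⟨τ, hP hτ, h⟩

/-- A client that has failed, or is busy propagating the tag `t`. -/
def ClientState.Engaged (st : ClientState W S V) (t : Tag W) : Prop :=
  st = .failed ∨ (∃ k v acks, st = .putData k t v acks) ∨ ∃ k v Sα acks, st = .confirm k t v Sα acks

/-- A *put-data* request or the effect of one, of client `c` for tag `t`, is around. -/
def Config.Residue (σ : Config W R S V) (c : Client W R) (t : Tag W) : Prop :=
  (∃ s, (t, c) ∈ (σ.server s).seen) ∨ ∃ k s v, Msg.req (.client c) k s (.putData t v) ∈ σ.net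

/-- Requests of one group-send are equal, and a request that has been answered is not in transit. -/
structure Config.Links (σ : Config W R S V) : Prop where
  req_unique : ∀ p k s m s' m', Msg.req p k s m ∈ σ.net → Msg.req p k s' m' ∈ σ.net → m = m'
  rep_req : ∀ s k p b m, Msg.rep s k p b ∈ σ.net → Msg.req p k s m ∉ σ.net
  acks_req : ∀ c k t v acks, σ.client c = .putData k t v acks →
    ∀ s ∈ acks, ∀ m, Msg.req (.client c) k s m ∉ σ.net

/-- What acknowledgements tell about the configurations `P` of the past. -/
structure Config.Confirms (P : Set (Config W R S V)) (σ : Config W R S V) : Prop where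
  seen : ∀ s t c, (t, c) ∈ (σ.server s).seen → σ.Holds t s
  residue : ∀ c t, σ.Residue c t → (σ.client c).Engaged t ∨ SafeIn P t
  putData : ∀ c k t v acks, σ.client c = .putData k t v acks → SafeIn P t ∨
    ∀ s k' v', Msg.req (.client c) k' s (.putData t v') ∈ σ.net → k' = k
  confirmReq : ∀ c k t v Sα acks, σ.client c = .confirm k t v Sα acks →
    ∀ s m, Msg.req (.client c) k s m ∈ σ.net → m = .confirmData t
  confirm : ∀ c k t v Sα acks, σ.client c = .confirm k t v Sα acks → SafeIn P t ∨
    ∃ τ ∈ P, ∀ s ∈ Sα, (∀ k' v', Msg.req (.client c) k' s (.putData t v') ∉ σ.net) ∧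
      ((t, c) ∈ (σ.server s).seen ∨ Msg.rep s k (.client c) .ack ∈ σ.net ∨ s ∈ acks → τ.Holds t s)

variable {t₀ : Tag W} {v₀ : V} {σ σ' : Config W R S V} {l : Label W R V}
  {P P' : Set (Config W R S V)}

theorem Config.Links.init : (Config.init t₀ v₀ : Config W R S V).Links := by
  constructor <;> simp [Config.init]

/-- New requests carry the identifier `nextId`, which by `IdsBelow` no older message or phase uses,
so old and new traffic cannot be confused. -/
theorem Config.Links.step (hσ : σ.Links) (hid : σ.IdsBelow) (h : Step t₀ v₀ σ l σ') :
    σ'.Links := by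
  refine ⟨?_, ?_, ?_⟩
  · intro p k s m s' m' h1 h2
    obtain ⟨m₀, hreq⟩ := h.net_req
    rcases hreq _ _ _ _ h1 with h1 | ⟨k1, -, rfl, -⟩ <;>
      rcases hreq _ _ _ _ h2 with h2 | ⟨k2, -, rfl, -⟩
    · exact hσ.req_unique _ _ _ _ _ _ h1 h2
    · exact absurd (hid.req _ _ _ _ h1) (by omega)
    · exact absurd (hid.req _ _ _ _ h2) (by omega)
    · rfl
  · intro s k p b m h1 h2
    rcases h.mem_net_req h2 with h2' | ⟨rfl, -⟩ <;>
      rcases h.mem_net_rep h1 with h1 | ⟨m', h1, h1', -⟩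
    · exact hσ.rep_req _ _ _ _ _ h1 h2'
    · rw [hσ.req_unique _ _ _ _ _ _ h1 h2'] at h1'
      exact h1' h2
    · exact absurd (hid.rep _ _ _ _ h1) (lt_irrefl _)
    · exact absurd (hid.req _ _ _ _ h1) (lt_irrefl _)
  · intro c k t v acks hk s hs m hm
    have hc := h.clientChange c
    generalize σ'.client c = x at hc hk
    have old : ∀ acks', σ.client c = .putData k t v acks' →
        Msg.req (.client c) k s m ∈ σ.net := by
      intro acks' hk'
      rcases h.mem_net_req hm with hm | ⟨rfl, -⟩
      · exact hm
      · exact absurd (hid.putData _ _ _ _ _ hk') (lt_irrefl _)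
    cases hc with
    | same => exact hσ.acks_req _ _ _ _ _ hk _ hs _ (old _ hk)
    | put => cases hk; cases hs
    | recv s' k' b hb =>
      obtain ⟨acks', h1, h2⟩ := ClientState.recv_eq_putData hk
      rcases h2 _ hs with h2 | ⟨rfl, rfl, -⟩
      · exact hσ.acks_req _ _ _ _ _ h1 _ h2 _ (old _ h1)
      · exact hσ.rep_req _ _ _ _ _ hb (old _ h1)
    | _ => cases hk

theorem Config.Confirms.init : (Config.init t₀ v₀ : Config W R S V).Confirms P := by
  constructor <;> simp [Config.init, ServerState.default, Config.Residue]

theorem Config.Confirms.mono (hσ : σ.Confirms P) (hP : P ⊆ P') : σ.Confirms P' where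
  seen := hσ.seen
  residue c t h := (hσ.residue c t h).imp_right (SafeIn.mono hP)
  putData c k t v acks h := (hσ.putData c k t v acks h).imp_left (SafeIn.mono hP)
  confirmReq := hσ.confirmReq
  confirm c k t v Sα acks h := (hσ.confirm c k t v Sα acks h).imp (SafeIn.mono hP)
    fun ⟨τ, hτ, h⟩ => ⟨τ, hP hτ, h⟩

open Classical in
-- The point is that one and the same `τ` serves all the servers that confirmed.
theorem Config.Confirms.safe (hσ : σ.Confirms P) {c k t v Sα acks}
    (h : σ.client c = .confirm k t v Sα acks) (hmaj : Majority (acks ∩ Sα)) : SafeIn P t := by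
  rcases hσ.confirm _ _ _ _ _ _ h with h | ⟨τ, hτ, h⟩
  · exact h
  · refine ⟨τ, hτ, _, hmaj, fun s hs => ?_⟩
    rw [Finset.mem_inter] at hs
    exact (h s hs.2).2 (.inr (.inr hs.1))

/-- A new entry of `Seen` comes from a request in transit, which is residue already; so residue
originates only at the start of a put-data phase. -/
theorem Step.residue (h : Step t₀ v₀ σ l σ') {c t} (hr : σ'.Residue c t) :
    σ.Residue c t ∨ ∃ v, PutStep σ σ' c t v := by
  rcases hr with ⟨s, hs⟩ | ⟨k, s, v, hm⟩
  · left
    have hc := h.serverChange s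
    generalize σ'.server s = x at hc hs
    cases hc with
    | same => exact .inl ⟨s, hs⟩
    | handle p k m hm =>
      rcases ServerState.handle_seen hs with hs | ⟨-, -, rfl, v, rfl⟩
      · exact .inl ⟨s, hs⟩
      · exact .inr ⟨_, _, _, hm⟩
    | recv s' k b hm =>
      rw [(ServerState.recv_fields (σ.server s) s' k b).2.2.1] at hs
      exact .inl ⟨s, hs⟩
    | crash => cases hs
    | initRepair => cases hs
    | endRepair => exact .inl ⟨s, hs⟩
  · rcases h.mem_net_req hm with hm | ⟨-, -, h⟩
    · exact .inl (.inr ⟨_, _, _, hm⟩)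
    · cases h with
      | put _ _ _ hp => exact .inr ⟨_, hp⟩

theorem PutStep.not_engaged {c t v t'} (h : PutStep σ σ' c t v) : ¬ (σ.client c).Engaged t' := by
  rcases h.client_before with ⟨k, resp, h⟩ | ⟨k, resp, h⟩ <;>
    simp [ClientState.Engaged, h]

/-- The clauses feed each other: `residue` rules out dangerous leftovers when put-data starts, which
gives `putData`; that clause and `Links.acks_req` show that no put-data request for `t` is in
transit to `Sα` when confirm-data starts; from then on an entry of `Seen` at a server in `Sα` can
only be lost, so it dates back to that start. -/
theorem Config.Confirms.step (hσ : σ.Confirms P) (hid : σ.IdsBelow) (hl : σ.Links)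
    (hP : σ' ∈ P) (h : Step t₀ v₀ σ l σ') : σ'.Confirms P := by
  have hseen : ∀ s t c, (t, c) ∈ (σ'.server s).seen → σ'.Holds t s := by
    intro s t c hs
    have hc := h.serverChange s
    unfold Config.Holds
    generalize σ'.server s = x at hc hs
    cases hc with
    | same => exact hσ.seen _ _ _ hs
    | handle p k m hm =>
      rw [ServerState.handle_status]
      rcases ServerState.handle_seen hs with hs | ⟨h1, h2, -⟩
      · exact ⟨(hσ.seen _ _ _ hs).1, (hσ.seen _ _ _ hs).2.trans (ServerState.le_handle_tloc ..)⟩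
      · exact ⟨h1, h2⟩
    | recv s' k b hm =>
      obtain ⟨h1, -, h3, h4⟩ := ServerState.recv_fields (σ.server s) s' k b
      rw [h3] at hs
      rw [h4, h1]
      exact hσ.seen _ _ _ hs
    | crash => cases hs
    | initRepair => cases hs
    -- The repair keeps `Seen`, but a server in repair has no entry there, since entries imply
    -- activity.
    | endRepair k resp t v hk =>
      have := (hσ.seen _ _ _ hs).1
      rw [hk] at this
      cases this
  refine ⟨hseen, ?_, ?_, ?_, ?_⟩
  · intro c t hr
    rcases h.residue hr with hr | ⟨v, hp⟩
    · rcases hσ.residue c t hr with he | hs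
      · have hc := h.clientChange c
        generalize σ'.client c = x at hc
        have engaged : ∀ x : ClientState W S V, σ.client c = x → x.Engaged t := fun _ h => h ▸ he
        cases hc with
        | same => exact .inl he
        | failed => exact .inl (.inl rfl)
        | invFailed => exact .inl (.inl rfl)
        | getTag _ _ _ h' => simpa [ClientState.Engaged] using engaged _ h'
        | getData _ _ h' => simpa [ClientState.Engaged] using engaged _ h'
        | put _ _ hp => exact absurd he hp.not_engaged
        | confirm _ _ _ _ h' =>
          have := engaged _ h'
          simp only [ClientState.Engaged] at this
          simp_all [ClientState.Engaged]
        -- A client stops being engaged without failing only by completing, and then its tag is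
        -- safe.
        | resp _ _ _ _ _ _ _ _ h' hmaj =>
          have := engaged _ h'
          simp [ClientState.Engaged] at this
          subst this
          exact .inr (hσ.safe h' hmaj)
        | recv s k b hm =>
          left
          rcases he with he | ⟨_, _, _, he⟩ | ⟨_, _, _, _, he⟩
          · left; rw [he]; rfl
          · right; left
            rw [he]
            unfold ClientState.recv
            cases b <;> simp
            split_ifs <;> simp
          · right; right
            rw [he]
            unfold ClientState.recv
            cases b <;> simp
            split_ifs <;> simp
      · exact .inr hs
    · left
      rcases hp.client_after with h | h
      · exact .inr (.inl ⟨_, _, _, h⟩)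
      · exact .inl h
  · intro c k t v acks hk
    have hc := h.clientChange c
    generalize σ'.client c = x at hc hk
    have old : ∀ k acks', σ.client c = .putData k t v acks' → SafeIn P t ∨
        ∀ s k' v', Msg.req (.client c) k' s (.putData t v') ∈ σ'.net → k' = k := by
      intro k acks' hk'
      refine (hσ.putData _ _ _ _ _ hk').imp_right fun hall s k' v' hm => ?_
      rcases h.mem_net_req hm with hm | ⟨-, -, hn⟩
      · exact hall _ _ _ hm
      · cases hn with
        | put _ _ _ hp => exact absurd (.inr (.inl ⟨_, _, _, hk'⟩)) (hp.not_engaged (t' := t))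
    cases hc with
    | same => exact old _ _ hk
    | put _ _ hp =>
      cases hk
      -- Residue at this point stems from an earlier operation with the same tag. The client, being
      -- in its query phase, is not engaged, so the tag is safe; without residue, every such request
      -- belongs to the new group-send.
      by_cases hr : σ.Residue c t
      · exact .inl ((hσ.residue _ _ hr).resolve_left hp.not_engaged)
      · refine .inr fun s k' v' hm => ?_
        rcases h.mem_net_req hm with hm | ⟨h1, -, -⟩
        · exact absurd (.inr ⟨_, _, _, hm⟩) hr
        · exact h1
    | recv s' k' b hb =>
      obtain ⟨acks', h1, h2⟩ := ClientState.recv_eq_putData hk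
      exact old _ _ h1
    | _ => cases hk
  · intro c k t v Sα acks hk s m hm
    have hc := h.clientChange c
    generalize σ'.client c = x at hc hk
    have old : ∀ acks', σ.client c = .confirm k t v Sα acks' → m = .confirmData t := by
      intro acks' hk'
      rcases h.mem_net_req hm with hm | ⟨rfl, -⟩
      · exact hσ.confirmReq _ _ _ _ _ _ hk' _ _ hm
      · exact absurd (hid.confirm _ _ _ _ _ _ hk') (lt_irrefl _)
    cases hc with
    | same => exact old _ hk
    | confirm _ _ _ _ hk' =>
      cases hk
      rcases h.mem_net_req hm with hm | ⟨-, -, hn⟩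
      · exact absurd (hid.req _ _ _ _ hm) (lt_irrefl _)
      · cases hn with
        | confirm _ _ _ _ _ h => rw [hk'] at h; cases h; rfl
        | put _ _ _ hp => exact absurd (.inr (.inl ⟨_, _, _, hk'⟩)) (hp.not_engaged (t' := t))
        | queryTag _ h => rw [hk'] at h; cases h
        | queryTagData _ h => rw [hk'] at h; cases h
    | recv s' k' b hb =>
      obtain ⟨acks', h1, -⟩ := ClientState.recv_eq_confirm hk
      exact old _ h1
    | _ => cases hk
  · intro c k t v Sα acks hk
    have hc := h.clientChange c
    generalize σ'.client c = x at hc hk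
    have noPut : ∀ s, (σ.client c).Engaged t →
        (∀ k' v', Msg.req (.client c) k' s (.putData t v') ∉ σ.net) →
        ∀ k' v', Msg.req (.client c) k' s (.putData t v') ∉ σ'.net := by
      intro s he hno k' v' hm
      rcases h.mem_net_req hm with hm | ⟨-, -, hn⟩
      · exact hno _ _ hm
      · cases hn with
        | put _ _ _ hp => exact hp.not_engaged he
    have old : ∀ acks', σ.client c = .confirm k t v Sα acks' →
        (∀ s ∈ acks, s ∈ acks' ∨ Msg.rep s k (.client c) .ack ∈ σ.net) → SafeIn P t ∨
        ∃ τ ∈ P, ∀ s ∈ Sα, (∀ k' v', Msg.req (.client c) k' s (.putData t v') ∉ σ'.net) ∧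
          ((t, c) ∈ (σ'.server s).seen ∨ Msg.rep s k (.client c) .ack ∈ σ'.net ∨ s ∈ acks →
            τ.Holds t s) := by
      intro acks' hk' hacks
      refine (hσ.confirm _ _ _ _ _ _ hk').imp_right fun ⟨τ, hτ, hall⟩ => ⟨τ, hτ, fun s hs => ?_⟩
      refine ⟨noPut s (.inr (.inr ⟨_, _, _, _, hk'⟩)) (hall s hs).1, fun hor => (hall s hs).2 ?_⟩
      rcases hor with hseen' | hrep | hack
      · left
        have hc := h.serverChange s
        generalize σ'.server s = x at hc hseen'
        cases hc with
        | same => exact hseen'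
        | handle p k m hm =>
          -- A fresh insertion of `(t, c)` would need a put-data request in transit to `s`, and
          -- there is none.
          rcases ServerState.handle_seen hseen' with hs' | ⟨-, -, rfl, v, rfl⟩
          · exact hs'
          · exact absurd hm ((hall s hs).1 _ _)
        | recv s' k b hm =>
          rwa [(ServerState.recv_fields (σ.server s) s' k b).2.2.1] at hseen'
        | crash => cases hseen'
        | initRepair => cases hseen'
        | endRepair => exact hseen'
      · rcases h.mem_net_rep hrep with hrep | ⟨m, hm, -, hb⟩
        · exact .inr (.inl hrep)
        -- The ack answers a confirm request, so it proves that the pair was still in `Seen`.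
        · obtain rfl := hσ.confirmReq _ _ _ _ _ _ hk' _ _ hm
          rcases ServerState.handle_ack hb with ⟨_, _, h⟩ | ⟨t', h, hs⟩
          · cases h
          · cases h; exact .inl hs
      · rcases hacks s hack with h | h
        · exact .inr (.inr h)
        · exact .inr (.inl h)
    cases hc with
    | same => exact old _ hk fun _ h => .inl h
    | confirm k₀ _ _ _ hk' =>
      cases hk
      -- The witness is the configuration in which the confirm phase begins; no ack for it can exist
      -- yet.
      refine (hσ.putData _ _ _ _ _ hk').imp_right fun hall => ⟨σ', hP, fun s hs => ⟨?_, ?_⟩⟩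
      · refine noPut s (.inr (.inl ⟨_, _, _, hk'⟩)) fun k' v' hm => ?_
        obtain rfl := hall _ _ _ hm
        exact hl.acks_req _ _ _ _ _ hk' _ hs _ hm
      · rintro (hs' | hrep | hack)
        · exact hseen _ _ _ hs'
        · rcases h.mem_net_rep hrep with hrep | ⟨m, hm, -, -⟩
          · exact absurd (hid.rep _ _ _ _ hrep) (lt_irrefl _)
          · exact absurd (hid.req _ _ _ _ hm) (lt_irrefl _)
        · cases hack
    | recv s' k' b hb =>
      obtain ⟨acks', h1, h2⟩ := ClientState.recv_eq_confirm hk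
      refine old _ h1 fun s hs => (h2 s hs).imp_right ?_
      rintro ⟨rfl, rfl, rfl⟩
      exact hb
    | _ => cases hk

end Confirmation

/-! ### Operations of an execution and their tags -/

section Operations

variable {W R S V : Type*} [Fintype S] [LinearOrder W] {t₀ : Tag W} {v₀ : V}

theorem lt_incremented_tag (t : Tag W) (w : W) : t < toLex ((ofLex t).1 + 1, w) :=
  Prod.Lex.lt_iff.2 (.inl (Nat.lt_succ_self _))

namespace Execution

variable (β : Execution W R S V t₀ v₀)

theorem change (m : ℕ) (c : Client W R) :
    ClientChange (β.cfg m) (β.cfg (m + 1)) c (β.label m) ((β.cfg (m + 1)).client c) := by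
  rcases β.step m with h | ⟨h1, h2⟩
  · exact h.clientChange c
  · have := ClientChange.same (σ := β.cfg m) (σ' := β.cfg (m + 1)) (c := c) (β.label m)
      (by simp [h1, Label.invClient]) (by simp [h1, Label.respClient])
    rwa [← h2] at this ⊢

theorem nextId_mono : Monotone fun m => (β.cfg m).nextId :=
  monotone_nat_of_le_succ fun m => by
    rcases β.step m with h | ⟨-, h⟩
    · exact h.nextId_le
    · rw [h]

theorem idsBelow (m : ℕ) : (β.cfg m).IdsBelow := by
  induction m with
  | zero => rw [β.init]; exact .init
  | succ m ih =>
    rcases β.step m with h | ⟨-, h⟩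
    · exact ih.step h
    · rwa [h]

theorem links (m : ℕ) : (β.cfg m).Links := by
  induction m with
  | zero => rw [β.init]; exact .init
  | succ m ih =>
    rcases β.step m with h | ⟨-, h⟩
    · exact ih.step (β.idsBelow m) h
    · rwa [h]

theorem locked {Q : Finset S} {t : Tag W} (hQ : Majority Q) {T m : ℕ} (hm : T ≤ m)
    (h : ∀ s ∈ Q, (β.cfg T).Holds t s) : (β.cfg m).Locked Q t (β.cfg T).nextId := by
  induction m, hm using Nat.le_induction with
  | base => exact .of_holds (β.idsBelow T) h
  | succ m _ ih =>
    rcases β.step m with h | ⟨-, h⟩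
    · exact ih.step hQ h
    · rwa [h]

/-- The configurations up to time `m`. -/
def past (m : ℕ) : Set (Config W R S V) := β.cfg '' Set.Iic m

theorem past_mono {m m' : ℕ} (h : m ≤ m') : β.past m ⊆ β.past m' :=
  Set.image_mono (Set.Iic_subset_Iic.2 h)

theorem confirms (m : ℕ) : (β.cfg m).Confirms (β.past m) := by
  induction m with
  | zero => rw [β.init]; exact .init
  | succ m ih =>
    -- The past is enlarged before the step, since the configuration reached may itself become the
    -- witness.
    have ih := ih.mono (β.past_mono m.le_succ)
    rcases β.step m with h | ⟨-, h⟩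
    · exact ih.step (β.idsBelow m) (β.links m) ⟨m + 1, Set.mem_Iic.2 le_rfl, rfl⟩ h
    · rwa [h]

/-- Just before step `m`, the latest event at client `c` is the invocation at step `i`. -/
def Current (c : Client W R) (i m : ℕ) : Prop :=
  i < m ∧ (β.label i).invClient = some c ∧
    ∀ k, i < k → k < m → (β.label k).invClient ≠ some c ∧ (β.label k).respClient ≠ some c

/-- Step `m` starts the *put-data* phase of client `c` with the pair `(t, v)`. -/
abbrev PutAt (m : ℕ) (c : Client W R) (t : Tag W) (v : V) : Prop :=
  PutStep (β.cfg m) (β.cfg (m + 1)) c t v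

/-- Operation `i` starts its *put-data* phase with tag `t`. -/
def HasTag (i : ℕ) (t : Tag W) : Prop :=
  ∃ c m v, β.Current c i m ∧ β.PutAt m c t v

variable {β}

theorem Current.unique {c : Client W R} {i i' m : ℕ} (h : β.Current c i m)
    (h' : β.Current c i' m) : i = i' := by
  by_contra hne
  rcases lt_or_gt_of_ne hne with hlt | hlt
  · exact (h.2.2 _ hlt h'.1).1 h'.2.1
  · exact (h'.2.2 _ hlt h.1).1 h.2.1

theorem Current.succ {c : Client W R} {i m : ℕ} (h : β.Current c i m)
    (hi : (β.label m).invClient ≠ some c) (hr : (β.label m).respClient ≠ some c) :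
    β.Current c i (m + 1) := by
  refine ⟨h.1.trans (Nat.lt_succ_self _), h.2.1, fun k h1 h2 => ?_⟩
  rcases Nat.lt_succ_iff_lt_or_eq.1 h2 with h2 | rfl
  · exact h.2.2 _ h1 h2
  · exact ⟨hi, hr⟩

theorem Current.self {c : Client W R} {i : ℕ} (h : (β.label i).invClient = some c) :
    β.Current c i (i + 1) :=
  ⟨Nat.lt_succ_self _, h, fun k h1 h2 => by omega⟩

variable (β)

/-- The state of client `c` at time `m` matches the operation that it is executing. -/
def Tracked (c : Client W R) (m : ℕ) : ClientState W S V → Prop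
  | .idle => ∀ i < m, (β.label i).invClient = some c →
      ∃ j, i < j ∧ j < m ∧ (β.label j).respClient = some c
  | .failed => True
  | .getTag v k _ => ∃ i w, β.Current c i m ∧ β.label i = .invWrite w v ∧
      k = (β.cfg i).nextId ∧ ∀ m', i < m' → m' < m → ∀ t v, ¬ β.PutAt m' c t v
  | .getData k _ => ∃ i, β.Current c i m ∧
      k = (β.cfg i).nextId ∧ ∀ m', i < m' → m' < m → ∀ t v, ¬ β.PutAt m' c t v
  | .putData _ t _ _ => ∃ i, β.Current c i m ∧ β.HasTag i t
  | .confirm _ t _ _ _ => ∃ i, β.Current c i m ∧ β.HasTag i t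

/-- This ties the phases to operations. The equation for `k` shows that a query was sent at the
invocation, hence after any earlier lock; the absence of earlier put-data starts makes the tag of an
operation unique. -/
theorem tracked (c : Client W R) (m : ℕ) : β.Tracked c m ((β.cfg m).client c) := by
  induction m with
  | zero =>
    rw [β.init]
    intro i hi
    exact absurd hi (Nat.not_lt_zero _)
  | succ m ih =>
    have hc := β.change m c
    -- a client that is still in its first phase has not started *put-data*
    have noPut : ∀ i, ((∃ v k resp, (β.cfg (m + 1)).client c = .getTag v k resp) ∨
        ∃ k resp, (β.cfg (m + 1)).client c = .getData k resp) →
        (∀ m', i < m' → m' < m → ∀ t v, ¬ β.PutAt m' c t v) →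
        ∀ m', i < m' → m' < m + 1 → ∀ t v, ¬ β.PutAt m' c t v := by
      intro i hst hno m' h1 h2 t v hp
      rcases Nat.lt_succ_iff_lt_or_eq.1 h2 with h2 | rfl
      · exact hno _ h1 h2 _ _ hp
      · rcases hp.client_after with h | h <;> rw [h] at hst <;> simp at hst
    generalize hx : (β.cfg (m + 1)).client c = x at hc noPut
    generalize hl : β.label m = l at hc
    cases hc with
    | same _ hi hr =>
      subst hl
      generalize (β.cfg m).client c = y at ih noPut
      cases y with
      | idle =>
        intro i hlt hinv
        rcases Nat.lt_succ_iff_lt_or_eq.1 hlt with hlt | rfl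
        · obtain ⟨j, h1, h2, h3⟩ := ih i hlt hinv
          exact ⟨j, h1, h2.trans (Nat.lt_succ_self _), h3⟩
        · exact absurd hinv hi
      | failed => trivial
      | getTag v k resp =>
        obtain ⟨i, w, h1, h2, h3, h4⟩ := ih
        exact ⟨i, w, h1.succ hi hr, h2, h3, noPut _ (.inl ⟨_, _, _, rfl⟩) h4⟩
      | getData k resp =>
        obtain ⟨i, h1, h3, h4⟩ := ih
        exact ⟨i, h1.succ hi hr, h3, noPut _ (.inr ⟨_, _, rfl⟩) h4⟩
      | putData k t v acks =>
        obtain ⟨i, h1, h2⟩ := ih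
        exact ⟨i, h1.succ hi hr, h2⟩
      | confirm k t v Sα acks =>
        obtain ⟨i, h1, h2⟩ := ih
        exact ⟨i, h1.succ hi hr, h2⟩
    | failed => trivial
    | invFailed => trivial
    | getTag w v hc h =>
      refine ⟨m, w, .self (by rw [hl, hc]; rfl), hl, rfl, fun m' h1 h2 => by omega⟩
    | getData r hc h =>
      refine ⟨m, .self (by rw [hl, hc]; rfl), rfl, fun m' h1 h2 => by omega⟩
    | put t v hp =>
      have : ∃ i, β.Current c i m := by
        rcases hp.client_before with ⟨k, resp, h⟩ | ⟨k, resp, h⟩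
        · rw [h] at ih
          obtain ⟨i, w, h1, -⟩ := ih
          exact ⟨i, h1⟩
        · rw [h] at ih
          obtain ⟨i, h1, -⟩ := ih
          exact ⟨i, h1⟩
      obtain ⟨i, hi⟩ := this
      exact ⟨i, hi.succ (by simp [hl, Label.invClient]) (by simp [hl, Label.respClient]),
        c, m, v, hi, hp⟩
    | confirm k t v acks h =>
      rw [h] at ih
      obtain ⟨i, hi, ht⟩ := ih
      exact ⟨i, hi.succ (by simp [hl, Label.invClient]) (by simp [hl, Label.respClient]), ht⟩
    | resp _ k t v Sα acks hr hv h hmaj =>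
      intro i hlt hinv
      rcases Nat.lt_succ_iff_lt_or_eq.1 hlt with hlt | rfl
      · exact ⟨m, hlt, Nat.lt_succ_self _, by rw [hl]; exact hr⟩
      · rw [hl] at hinv
        cases l <;> simp [Label.invClient, Label.respClient] at hinv hr
    | recv s k b hb =>
      have hi : (β.label m).invClient ≠ some c := by simp [hl, Label.invClient]
      have hr : (β.label m).respClient ≠ some c := by simp [hl, Label.respClient]
      generalize hy : ((β.cfg m).client c).recv s k b = y at noPut
      cases y with
      | idle =>
        rw [ClientState.recv_eq_idle hy] at ih
        intro i hlt hinv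
        rcases Nat.lt_succ_iff_lt_or_eq.1 hlt with hlt | rfl
        · obtain ⟨j, h1, h2, h3⟩ := ih i hlt hinv
          exact ⟨j, h1, h2.trans (Nat.lt_succ_self _), h3⟩
        · exact absurd hinv hi
      | failed => trivial
      | getTag v k resp =>
        obtain ⟨_, h, -⟩ := ClientState.recv_eq_getTag hy
        rw [h] at ih
        obtain ⟨i, w, h1, h2, h3, h4⟩ := ih
        exact ⟨i, w, h1.succ hi hr, h2, h3, noPut _ (.inl ⟨_, _, _, rfl⟩) h4⟩
      | getData k resp =>
        obtain ⟨_, h, -⟩ := ClientState.recv_eq_getData hy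
        rw [h] at ih
        obtain ⟨i, h1, h3, h4⟩ := ih
        exact ⟨i, h1.succ hi hr, h3, noPut _ (.inr ⟨_, _, rfl⟩) h4⟩
      | putData k t v acks =>
        obtain ⟨_, h, -⟩ := ClientState.recv_eq_putData hy
        rw [h] at ih
        obtain ⟨i, h1, h2⟩ := ih
        exact ⟨i, h1.succ hi hr, h2⟩
      | confirm k t v Sα acks =>
        obtain ⟨_, h, -⟩ := ClientState.recv_eq_confirm hy
        rw [h] at ih
        obtain ⟨i, h1, h2⟩ := ih
        exact ⟨i, h1.succ hi hr, h2⟩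

theorem idle_of_inv {m : ℕ} {c : Client W R} (h : (β.label m).invClient = some c) :
    (β.cfg m).client c = .idle := by
  have hc := β.change m c
  generalize (β.cfg (m + 1)).client c = x at hc
  generalize β.label m = l at hc h
  cases hc with
  | same _ hi => exact absurd h hi
  | invFailed _ _ h => exact h
  | getTag _ _ _ h' => exact h'
  | getData _ _ h' => exact h'
  | resp _ _ _ _ _ _ hr => cases l <;> simp [Label.invClient, Label.respClient] at h hr
  | _ => simp [Label.invClient] at h

/-- A client completes its operation before it invokes the next one. -/
theorem completes_before_next {i i' : ℕ} {c : Client W R} (hi : (β.label i).invClient = some c)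
    (hi' : (β.label i').invClient = some c) (hlt : i < i') :
    ∃ j, CompletesAt β.label i j ∧ j < i' := by
  classical
  have ht := β.tracked c i'
  rw [β.idle_of_inv hi'] at ht
  have hex : ∃ j, i < j ∧ (β.label j).respClient = some c :=
    (ht i hlt hi).imp fun j h => ⟨h.1, h.2.2⟩
  obtain ⟨j, h1, h2, h3⟩ := ht i hlt hi
  -- `CompletesAt` asks for the first response after `i`, hence the minimal one.
  refine ⟨Nat.find hex, ⟨(Nat.find_spec hex).1, c, hi, (Nat.find_spec hex).2, ?_⟩,
    (Nat.find_min' hex ⟨h1, h3⟩).trans_lt h2⟩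
  exact fun k hk hlt h => Nat.find_min hex hlt ⟨hk, h⟩

/-- A complete operation has a tag, which is safe by the time of the response. -/
theorem exists_tag_of_completesAt {i j : ℕ} (h : CompletesAt β.label i j) :
    ∃ c k t v Sα acks, (β.cfg j).client c = .confirm k t v Sα acks ∧ β.HasTag i t ∧
      SafeIn (β.past j) t ∧ ∀ r v', β.label j = .respRead r v' → v' = v := by
  obtain ⟨hlt, c, hi, hj, hmin⟩ := h
  have hc := β.change j c
  generalize (β.cfg (j + 1)).client c = x at hc
  generalize hl : β.label j = l at hc hj
  have ht := β.tracked c j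
  cases hc with
  | same _ _ hr => exact absurd hj hr
  | invFailed _ h => cases l <;> simp [Label.invClient, Label.respClient] at h hj
  | resp _ k t v Sα acks hr hv h hmaj =>
    rw [h] at ht
    obtain ⟨i₀, hcur, htag⟩ := ht
    -- If `i₀ < i`, then `i` would be an event after the latest one; if `i < i₀`, then `i` would
    -- have a response before `j`.
    have : i₀ = i := by
      by_contra hne
      rcases lt_or_gt_of_ne hne with hne | hne
      · exact (hcur.2.2 _ hne hlt).1 hi
      · obtain ⟨j', ⟨h1, c', h2, h3, -⟩, h4⟩ := β.completes_before_next hi hcur.2.1 hne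
        rw [hi] at h2
        cases h2
        exact hmin j' h1 (h4.trans hcur.1) h3
    subst this
    exact ⟨c, k, t, v, Sα, acks, h, htag, (β.confirms j).safe h hmaj, hv⟩
  | _ => simp [Label.respClient] at hj

theorem HasTag.unique {i : ℕ} {t t' : Tag W} (h : β.HasTag i t) (h' : β.HasTag i t') : t = t' := by
  have key : ∀ {c m m' t t' v v'}, β.Current c i m → β.PutAt m c t v → β.Current c i m' →
      β.PutAt m' c t' v' → ¬ m < m' := by
    intro c m m' t t' v v' hc hp hc' hp' hlt
    have ht := β.tracked c m'
    rcases hp'.client_before with ⟨k, resp, h⟩ | ⟨k, resp, h⟩ <;> rw [h] at ht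
    · obtain ⟨i', _, hc'', -, -, hno⟩ := ht
      obtain rfl := hc'.unique hc''
      exact hno m hc.1 hlt _ _ hp
    · obtain ⟨i', hc'', -, hno⟩ := ht
      obtain rfl := hc'.unique hc''
      exact hno m hc.1 hlt _ _ hp
  obtain ⟨c, m, v, hc, hp⟩ := h
  obtain ⟨c', m', v', hc', hp'⟩ := h'
  obtain rfl : c = c' := Option.some.inj (hc.2.1.symm.trans hc'.2.1)
  obtain rfl : m = m' := le_antisymm (not_lt.1 (key hc' hp' hc hp)) (not_lt.1 (key hc hp hc' hp'))
  exact hp.tag_unique hp'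

/-- A tag that is safe when an operation is invoked is a lower bound for the tag of the operation,
and a strict one if the operation is a write. -/
theorem HasTag.ge_of_safe {i : ℕ} {t t' : Tag W} (hs : SafeIn (β.past i) t)
    (h : β.HasTag i t') : t ≤ t' ∧ (IsWrite β.label i → t < t') := by
  obtain ⟨_, ⟨T, hT, rfl⟩, Q, hQ, hQt⟩ := hs
  obtain ⟨c, m, v, hc, hp⟩ := h
  -- The query is sent at step `i`, not before `T`, so its identifier is in the range of the lock
  -- and some recorded response comes from `Q`.
  have hlock := β.locked hQ (le_trans hT hc.1.le) hQt
  have ht := β.tracked c m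
  cases hp with
  | writer w v k resp t' D h hmaj hmem hmax =>
    rw [h] at ht
    obtain ⟨i', _, hc', -, rfl, -⟩ := ht
    obtain rfl := hc.unique hc'
    obtain ⟨s, hs, a, ha⟩ := exists_resp_of_majority hQ hmaj
    have hlt := ((hlock.getTag _ _ _ _ h (β.nextId_mono hT) s hs _ ha).trans
      (hmax _ _ ha)).trans_lt (lt_incremented_tag t' w)
    exact ⟨hlt.le, fun _ => hlt⟩
  | reader r k resp t' v D h hmaj hmax =>
    rw [h] at ht
    obtain ⟨i', hc', rfl, -⟩ := ht
    obtain rfl := hc.unique hc'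
    obtain ⟨s, hs, ⟨a, b⟩, ha⟩ := exists_resp_of_majority hQ hmaj
    refine ⟨(hlock.getData _ _ _ h (β.nextId_mono hT) s hs _ _ ha).trans (hmax.2 _ _ _ ha), ?_⟩
    rintro ⟨w, v, hw⟩
    have := hc.2.1
    simp [hw, Label.invClient] at this

theorem HasTag.ge_of_completesAt {i j i' : ℕ} {t t' : Tag W} (h : CompletesAt β.label i j)
    (ht : β.HasTag i t) (hlt : j < i') (ht' : β.HasTag i' t') :
    t ≤ t' ∧ (IsWrite β.label i' → t < t') := by
  obtain ⟨c, k, t₁, v, Sα, acks, -, h1, h2, -⟩ := β.exists_tag_of_completesAt h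
  obtain rfl := HasTag.unique β ht h1
  exact HasTag.ge_of_safe β (h2.mono (β.past_mono hlt.le)) ht'

theorem HasTag.isOp {i : ℕ} {t : Tag W} (h : β.HasTag i t) : IsOp β.label i :=
  let ⟨c, _, _, h, _⟩ := h
  ⟨c, h.2.1⟩

/-- Different writes have different tags. -/
theorem HasTag.write_unique {i i' : ℕ} {t : Tag W} (hi : IsWrite β.label i)
    (hi' : IsWrite β.label i') (h : β.HasTag i t) (h' : β.HasTag i' t) : i = i' := by
  -- The second component of the tag names the writer. Two writes with one tag are thus at one
  -- client, hence sequential, and the later one has a strictly larger tag.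
  have writer : ∀ {i}, IsWrite β.label i → β.HasTag i t →
      (β.label i).invClient = some (.writer (ofLex t).2) := by
    rintro i ⟨w, v, hw⟩ ⟨c, m, v', hc, hp⟩
    cases hp with
    | writer => exact hc.2.1
    | reader =>
      have := hc.2.1
      simp [hw, Label.invClient] at this
  by_contra hne
  rcases lt_or_gt_of_ne hne with hlt | hlt
  · obtain ⟨j, h1, h2⟩ := β.completes_before_next (writer hi h) (writer hi' h') hlt
    exact lt_irrefl _ ((HasTag.ge_of_completesAt β h1 h h2 h').2 hi')
  · obtain ⟨j, h1, h2⟩ := β.completes_before_next (writer hi' h') (writer hi h) hlt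
    exact lt_irrefl _ ((HasTag.ge_of_completesAt β h1 h' h2 h).2 hi)

/-- The initial tag is arbitrary and need not be least in the order, but every other tag that occurs
arises from it by increments. -/
theorem initial_le_tags (m : ℕ) : (β.cfg m).PairsIn fun t _ => t₀ ≤ t := by
  induction m with
  | zero => rw [β.init]; exact .init le_rfl
  | succ m ih =>
    rcases β.step m with h | ⟨-, h⟩
    · refine ih.step le_rfl (fun w t v hp => ?_) h
      cases hp with
      | writer w v k resp t D h hmaj hmem hmax =>
        obtain ⟨s, hs⟩ := hmem
        obtain ⟨_, h'⟩ := ih.getTag _ _ _ _ h _ _ hs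
        exact h'.trans (lt_incremented_tag t w).le
    · rwa [h]

theorem HasTag.initial_lt {i : ℕ} {t : Tag W} (hi : IsWrite β.label i) (h : β.HasTag i t) :
    t₀ < t := by
  obtain ⟨w, v, hw⟩ := hi
  obtain ⟨c, m, v', hc, hp⟩ := h
  cases hp with
  | writer w v k resp t D h hmaj hmem hmax =>
    obtain ⟨s, hs⟩ := hmem
    obtain ⟨_, h'⟩ := (β.initial_le_tags m).getTag _ _ _ _ h _ _ hs
    exact h'.trans_lt (lt_incremented_tag t w)
  | reader =>
    have := hc.2.1
    simp [hw, Label.invClient] at this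

/-- Every pair in the system is the initial one or the one of a write operation. -/
theorem pairs_written (m : ℕ) : (β.cfg m).PairsIn fun t v =>
    (t = t₀ ∧ v = v₀) ∨ ∃ i w, β.HasTag i t ∧ β.label i = .invWrite w v := by
  induction m with
  | zero => rw [β.init]; exact .init (.inl ⟨rfl, rfl⟩)
  | succ m ih =>
    rcases β.step m with h | ⟨-, h⟩
    · refine ih.step (.inl ⟨rfl, rfl⟩) (fun w t v hp => ?_) h
      have hp' := hp
      cases hp with
      | writer w v k resp t D h hmaj hmem hmax =>
        have ht := β.tracked (.writer w) m
        rw [h] at ht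
        obtain ⟨i, w', hc, hw, -⟩ := ht
        exact .inr ⟨i, w', ⟨_, m, _, hc, hp'⟩, hw⟩
    · rwa [h]

theorem read_value {i j : ℕ} {r : R} {v : V} {t : Tag W} (h : CompletesAt β.label i j)
    (hj : β.label j = .respRead r v) (ht : β.HasTag i t) :
    (t = t₀ ∧ v = v₀) ∨ ∃ i w, β.HasTag i t ∧ β.label i = .invWrite w v := by
  obtain ⟨c, k, t₁, v', Sα, acks, h1, h2, -, h4⟩ := β.exists_tag_of_completesAt h
  obtain rfl := HasTag.unique β ht h2
  obtain rfl := h4 _ _ hj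
  exact (β.pairs_written j).confirm _ _ _ _ _ _ h1

end Execution

end Operations

/-! ### From tags to serialization points -/

section Serialization

/-- A linear order on a set `L` of natural numbers with finite initial segments is realized by
real points, where the point of `i` exceeds the members of the initial segment of `i`, but no
larger natural number. -/
theorem exists_points {κ : Type*} [LinearOrder κ] (L : Set ℕ) (key : ℕ → κ)
    (hfin : ∀ i ∈ L, {k ∈ L | key k ≤ key i}.Finite) :
    ∃ pt : ℕ → ℝ, (∀ i ∈ L, (i : ℝ) < pt i) ∧
      (∀ i ∈ L, ∀ k ∈ L, key i < key k → pt i < pt k) ∧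
      ∀ i ∈ L, ∀ j : ℕ, (∀ k ∈ L, key k ≤ key i → k < j) → pt i < j := by
  classical
  let B : ℕ → Finset ℕ := fun i => if h : i ∈ L then (hfin i h).toFinset else ∅
  have hB : ∀ i ∈ L, ∀ k, k ∈ B i ↔ k ∈ L ∧ key k ≤ key i := by
    intro i hi k
    simp [B, hi]
  let M : ℕ → ℕ := fun i => (B i).sup id
  have hM : ∀ i, ∀ k ∈ B i, k ≤ M i := fun i k hk => Finset.le_sup (f := id) hk
  have hself : ∀ i ∈ L, i ∈ B i := fun i hi => (hB i hi i).2 ⟨hi, le_rfl⟩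
  have hcard : ∀ i, (B i).card < M i + 2 := by
    intro i
    have : B i ⊆ Finset.range (M i + 1) := fun k hk =>
      Finset.mem_range.2 (Nat.lt_succ_of_le (hM i k hk))
    have := Finset.card_le_card this
    rw [Finset.card_range] at this
    omega
  have hpos : ∀ n : ℕ, (0 : ℝ) < n + 2 := fun n => by positivity
  -- `M i` is the latest invocation in the initial segment `B i`. As `B i` lies in `{0, …, M i}`,
  -- the fraction is strictly between 0 and 1; it separates operations with the same `M i` by the
  -- size of their segments.
  let pt : ℕ → ℝ := fun i => M i + (B i).card / (M i + 2)
  have hlow : ∀ i ∈ L, (M i : ℝ) < pt i := by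
    intro i hi
    have : 0 < (B i).card := Finset.card_pos.2 ⟨i, hself i hi⟩
    have : (0 : ℝ) < (B i).card / (M i + 2) :=
      div_pos (Nat.cast_pos.2 this) (hpos _)
    simpa [pt] using this
  have hhigh : ∀ i, pt i < (M i : ℝ) + 1 := by
    intro i
    have : ((B i).card : ℝ) < M i + 2 := by exact_mod_cast hcard i
    have : ((B i).card : ℝ) / (M i + 2) < 1 := (div_lt_one (hpos _)).2 this
    simpa [pt] using this
  refine ⟨pt, fun i hi => ?_, fun i hi k hk hlt => ?_, fun i hi j hj => ?_⟩
  · exact lt_of_le_of_lt (by exact_mod_cast hM i i (hself i hi)) (hlow i hi)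
  · have hsub : B i ⊂ B k := by
      refine Finset.ssubset_iff_subset_ne.2 ⟨fun x hx => ?_, fun heq => ?_⟩
      · rw [hB i hi] at hx
        exact (hB k hk x).2 ⟨hx.1, hx.2.trans hlt.le⟩
      · have := hself k hk
        rw [← heq, hB i hi] at this
        exact this.2.not_gt hlt
    have hMle : M i ≤ M k := Finset.sup_mono hsub.1
    rcases hMle.lt_or_eq with h | h
    · have : (M i : ℝ) + 1 ≤ M k := by exact_mod_cast h
      exact (hhigh i).trans_le (this.trans (hlow k hk).le)
    · have hc : ((B i).card : ℝ) < (B k).card := by exact_mod_cast Finset.card_lt_card hsub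
      simp only [pt]
      rw [h]
      exact add_lt_add_right (div_lt_div_of_pos_right hc (hpos _)) _
  · have : M i < j := by
      obtain ⟨k, hk, hMk⟩ := Finset.exists_mem_eq_sup (B i) ⟨i, hself i hi⟩ id
      have hMk : M i = k := hMk
      rw [hMk]
      rw [hB i hi] at hk
      exact hj k hk.1 hk.2
    have : (M i : ℝ) + 1 ≤ j := by exact_mod_cast this
    exact (hhigh i).trans_le this

variable {W R V : Type*}

theorem not_inv_and_resp {l : Label W R V} {c c' : Client W R} (h : l.invClient = some c)
    (h' : l.respClient = some c') : False := by
  cases l <;> simp [Label.invClient, Label.respClient] at h h'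

/-- A history is atomic if tags can be assigned to its operations, in agreement with their order in
real time and with the values that are read. -/
theorem atomic_of_tags {τ : Type*} [LinearOrder τ] (v₀ : V) (t₀ : τ) (h : ℕ → Label W R V)
    (HasTag : ℕ → τ → Prop)
    (isOp : ∀ i t, HasTag i t → IsOp h i)
    (unique : ∀ i t t', HasTag i t → HasTag i t' → t = t')
    (complete : ∀ i j, CompletesAt h i j → ∃ t, HasTag i t)
    (realTime : ∀ i j i' t t', CompletesAt h i j → HasTag i t → j < i' → HasTag i' t' →
      t ≤ t' ∧ (IsWrite h i' → t < t'))
    (writeUnique : ∀ i i' t, IsWrite h i → IsWrite h i' → HasTag i t → HasTag i' t → i = i')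
    (initial_lt : ∀ i t, IsWrite h i → HasTag i t → t₀ < t)
    (value : ∀ i j r v t, CompletesAt h i j → h j = .respRead r v → HasTag i t →
      (t = t₀ ∧ v = v₀) ∨ ∃ k w, HasTag k t ∧ h k = .invWrite w v) :
    Atomic v₀ h := by
  classical
  -- The default is immaterial: only operations that have a tag enter `L`.
  let tag : ℕ → τ := fun i => if hi : ∃ t, HasTag i t then hi.choose else t₀
  have tag_eq : ∀ {i t}, HasTag i t → tag i = t := by
    intro i t ht
    have hi : ∃ t, HasTag i t := ⟨t, ht⟩
    simp only [tag, dif_pos hi]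
    exact unique _ _ _ hi.choose_spec ht
  let kind : ℕ → ℕ := fun i => if IsWrite h i then 0 else 1
  -- Among equal tags the write comes before the reads that return it, and the reads follow the
  -- order of invocation.
  let key : ℕ → τ ×ₗ ℕ ×ₗ ℕ := fun i => toLex (tag i, toLex (kind i, i))
  have key_inj : ∀ {i k}, key i = key k → i = k := by
    intro i k hik
    simp only [key, EmbeddingLike.apply_eq_iff_eq, Prod.mk.injEq] at hik
    exact hik.2.2
  -- Incomplete operations are kept only below a complete one. This includes every write whose value
  -- a complete read returns, and makes initial segments finite.
  let L : Set ℕ := {i | (∃ t, HasTag i t) ∧ ∃ i' j', CompletesAt h i' j' ∧ key i ≤ key i'}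
  -- an operation that precedes a complete one in the order is invoked before its response
  have before : ∀ {i j k}, CompletesAt h i j → k ∈ L → key k ≤ key i → k < j := by
    intro i j k hij hk hle
    obtain ⟨⟨t', ht'⟩, -⟩ := hk
    obtain ⟨t, ht⟩ := complete _ _ hij
    by_contra hlt
    rcases (not_lt.1 hlt).eq_or_lt with rfl | hlt
    · obtain ⟨c, hc⟩ := isOp _ _ ht'
      obtain ⟨-, c', -, hc', -⟩ := hij
      exact not_inv_and_resp hc hc'
    · obtain ⟨h1, h2⟩ := realTime _ _ _ _ _ hij ht hlt ht'
      simp only [key, Prod.Lex.toLex_le_toLex, tag_eq ht, tag_eq ht'] at hle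
      rcases hle with hle | ⟨rfl, hle⟩
      · exact hle.not_ge h1
      -- With equal tags, `k` is not a write, so the order could place it before `i` only if `k ≤
      -- i`, against `i < j < k`.
      · have hw : ¬ IsWrite h k := fun hw => lt_irrefl _ (h2 hw)
        simp only [kind, if_neg hw] at hle
        have := hij.1
        split_ifs at hle <;> omega
  have hfin : ∀ i ∈ L, {k ∈ L | key k ≤ key i}.Finite := by
    rintro i ⟨-, i', j', hc, hle⟩
    exact (Set.finite_Iio j').subset fun k hk => before hc hk.1 (hk.2.trans hle)
  have mem_L : ∀ {i j}, CompletesAt h i j → i ∈ L := fun hij =>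
    ⟨complete _ _ hij, _, _, hij, le_rfl⟩
  obtain ⟨pt, hlow, hmono, hhigh⟩ := exists_points L key hfin
  have key_lt : ∀ {i k}, i ∈ L → k ∈ L → pt i < pt k → key i < key k := by
    intro i k hi hk hlt
    by_contra hle
    rcases (not_lt.1 hle).eq_or_lt with heq | hlt'
    · rw [key_inj heq] at hlt
      exact lt_irrefl _ hlt
    · exact lt_asymm hlt (hmono _ hk _ hi hlt')
  refine ⟨L, pt, fun i hi => ?_, fun i j => mem_L, fun i hi k hk heq => ?_, hlow,
    fun i j hij => hhigh i (mem_L hij) j fun k => before hij, ?_⟩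
  · obtain ⟨⟨t, ht⟩, -⟩ := hi
    exact isOp _ _ ht
  · by_contra hne
    rcases lt_or_gt_of_ne (fun h => hne (key_inj h)) with hlt | hlt
    · exact (hmono _ hi _ hk hlt).ne heq
    · exact (hmono _ hk _ hi hlt).ne' heq
  · intro i j r v hij hi hj
    obtain ⟨t, ht⟩ := complete _ _ hij
    have hread : ¬ IsWrite h i := by rintro ⟨w, v, hw⟩; rw [hi] at hw; cases hw
    have tag_le : ∀ k ∈ L, pt k < pt i → tag k ≤ t := by
      intro k hk hlt
      have := (key_lt hk (mem_L hij) hlt).le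
      simp only [key, Prod.Lex.toLex_le_toLex, tag_eq ht] at this
      rcases this with h | h
      · exact h.le
      · exact h.1.le
    rcases value _ _ _ _ _ hij hj ht with ⟨rfl, rfl⟩ | ⟨k, w, hk, hkw⟩
    · refine .inr ⟨rfl, fun k hk hw hlt => ?_⟩
      have hle := tag_le k hk hlt
      obtain ⟨⟨t', ht'⟩, -⟩ := hk
      rw [tag_eq ht'] at hle
      exact hle.not_gt (initial_lt _ _ hw ht')
    · have hwk : IsWrite h k := ⟨w, v, hkw⟩
      have hlt : key k < key i := by
        simp only [key, Prod.Lex.toLex_lt_toLex, tag_eq ht, tag_eq hk, kind, if_pos hwk,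
          if_neg hread]
        exact .inr ⟨trivial, .inl Nat.zero_lt_one⟩
      -- The write may be incomplete; it belongs to `L` because it precedes the complete read.
      have hkL : k ∈ L := ⟨⟨t, hk⟩, i, j, hij, hlt.le⟩
      refine .inl ⟨k, hkL, ⟨w, hkw⟩, hmono _ hkL _ (mem_L hij) hlt, fun k' hk' hw' hlt' => ?_⟩
      have hle := tag_le k' hk' hlt'
      obtain ⟨⟨t', ht'⟩, -⟩ := id hk'
      rw [tag_eq ht'] at hle
      -- A write before the read has a tag at most `t`: with equality it is `k` itself, otherwise it
      -- comes before `k`.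
      rcases hle.eq_or_lt with rfl | hlt''
      · rw [writeUnique _ _ _ hw' hwk ht' hk]
      · refine (hmono _ hk' _ hkL ?_).le
        simp only [key, Prod.Lex.toLex_lt_toLex, tag_eq ht', tag_eq hk]
        exact .inl hlt''

end Serialization

end RadonS

theorem theorem7 {W R S V : Type*} [LinearOrder W] [Fintype S]
    (t₀ : RadonS.Tag W) (v₀ : V) (β : RadonS.Execution W R S V t₀ v₀) :
    RadonS.Atomic v₀ β.label := by
  refine RadonS.atomic_of_tags v₀ t₀ β.label β.HasTag
    (fun _ _ => RadonS.Execution.HasTag.isOp β)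
    (fun _ _ _ => RadonS.Execution.HasTag.unique β)
    (fun i j h => ?_)
    (fun _ _ _ _ _ => RadonS.Execution.HasTag.ge_of_completesAt β)
    (fun _ _ _ => RadonS.Execution.HasTag.write_unique β)
    (fun _ _ => RadonS.Execution.HasTag.initial_lt β)
    (fun _ _ _ _ _ => β.read_value)
  obtain ⟨_, _, t, _, _, _, _, ht, -⟩ := β.exists_tag_of_completesAt h
  exact ⟨t, ht⟩
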